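/- A partition is an $n$-core if no hook length of its Young diagram is a multiple of $n$, and an $(s,ms-1,ms+1)$-core if it is an $s$-core, an $(ms-1)$-core and an $(ms+1)$-core. The $\beta$-set of a partition is the set of hook lengths of the boxes in the first column of its Young diagram. For positive integers $s,m$ let $\mathcal L_m(s)=P_1\cup\dots\cup P_m$, where $P_k=\{\,msi+j : i,j\ge 0,\ (k-1)s+1+i\le j\le ks-1-i\,\}$ for $1\le k\le m-1$ and $P_m=\{\,msi+j : i,j\ge 0,\ (m-1)s+1+i\le j\le ms-2-i\,\}$. **Theorem.** Let $s,m\ge 1$ be integers. The largest size of an $(s,ms-1,ms+1)$-core partition is $$\frac{m^2t(t-1)(t^2-t+1)}{6}\quad\text{if } s=2t-1,\qquad \frac{m^2(t-1)^2(t^2-2t+3)}{6}-\frac{m(t-1)^2}{2}\quad\text{if } s=2t-2.$$ There is a partition $\lambda$ with $\beta$-set $\mathcal L_m(s)$, and the $(s,ms-1,ms+1)$-core partitions of largest size are precisely $\lambda$ and its conjugate. If $s\ge 3$, and moreover $m\ge 2$ or $s$ is even, then $\lambda$ is not self-conjugate, so that there are exactly two partitions of largest size. -/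

import Mathlib

namespace CorePartition

/-- Partitions are Young diagrams in English notation, with rows and columns indexed from `0`:
the parts are the row lengths, the size is the number of cells, the conjugate is the transpose.
The hook length of the cell `(i, j)` of `μ`: the number of cells of `μ` strictly to its right,
plus the number of cells strictly below it, plus one for the cell itself. -/
def hookLength (μ : YoungDiagram) (i j : ℕ) : ℕ :=
  (μ.rowLen i - (j + 1)) + (μ.colLen j - (i + 1)) + 1

/-- `μ` is an `n`-core: no hook length of a cell of `μ` is a multiple of `n`. -/
def IsCore (n : ℕ) (μ : YoungDiagram) : Prop :=
  ∀ i j : ℕ, (i, j) ∈ μ → ¬ n ∣ hookLength μ i j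

/-- The set of all `(s, ms - 1, ms + 1)`-core partitions. -/
def cores (s m : ℕ) : Set YoungDiagram :=
  {μ | IsCore s μ ∧ IsCore (m * s - 1) μ ∧ IsCore (m * s + 1) μ}

/-- The `β`-set of a partition: the set of hook lengths of the cells of the first column. -/
def betaSet (μ : YoungDiagram) : Finset ℕ :=
  (Finset.range (μ.colLen 0)).image fun i => hookLength μ i 0

/-- The `N`-pyramid with base `[a, b]`: the positions `(i, j)`, in row `i` and column `j` of the
`N`-abacus, with `a + i ≤ j ≤ b - i`. The position `(i, j)` is identified with the number
`N * i + j` that stands there. -/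
def pyramid (N a b : ℕ) : Set ℕ :=
  {x | ∃ i j : ℕ, a + i ≤ j ∧ j + i ≤ b ∧ x = N * i + j}

/-- `𝓛_m(s)`: the union of the `ms`-pyramids with bases `[(k - 1)s + 1, ks - 1]` for
`1 ≤ k ≤ m - 1` and of the `ms`-pyramid with base `[(m - 1)s + 1, ms - 2]`. -/
def bigL (m s : ℕ) : Set ℕ :=
  (⋃ k ∈ Finset.Icc 1 (m - 1), pyramid (m * s) ((k - 1) * s + 1) (k * s - 1)) ∪
    pyramid (m * s) ((m - 1) * s + 1) (m * s - 2)

end CorePartition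

namespace CorePartition

/-! The size problem becomes the minimisation of a quadratic form over bounded integer sequences. A
partition is an `n`-core exactly when subtracting `n` from any element `≥ n` of its β-set stays
inside the β-set (`isCore_iff`). An `s`-core is therefore given by its counts `n r` on the runners
of the `s`-abacus, with `n 0 = 0`. Continue them by `-1` at `s` and let `e i` be the successive
differences. They have sum `-1`, and the two conditions modulo `ms ± 1` say precisely that `|e i| ≤
m` (`isStepSeq_steps`, `mem_cores_of_steps`). Moreover `4 |μ|` is minus the energy of `e` for the
kernel `d (s - d)`, `d = |i - j|` (`IsRunnerCount.energy_steps`).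

The energy is strictly concave in every direction that raises one step and lowers another, so a
minimiser has at most one step different from `±m`, and the sum fixes its value and the number of
steps `-m` (`IsStepSeq.exists_hasShape`). If `Q` holds the steps `-m` and `z` is the special step,
then up to a constant the energy is a nonnegative combination of the energies of the sets `Q` and
`insert z Q` (`HasShape.energy_eq`). Among sets of given size, intervals have least energy
(`setEnergy_range_card_le`), and equality is rigid enough (`eq_or_eq_of_setEnergy_eq`) that the
signs of the first and last steps leave two sequences.

One of these has β-set `bigL m s`. The other is identified without computing a conjugate:
transposition preserves cores and size, and outside the degenerate cases the maximal core is not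
self-conjugate, so its conjugate must have the second sequence. -/

/-! ### β-sets: cores, size, and the bijection with finite sets of positive integers -/

theorem hookLength_transpose (μ : YoungDiagram) (i j : ℕ) :
    hookLength μ.transpose i j = hookLength μ j i := by
  simp only [hookLength, YoungDiagram.rowLen_transpose, YoungDiagram.colLen_transpose]
  omega

theorem IsCore.transpose {n : ℕ} {μ : YoungDiagram} (h : IsCore n μ) : IsCore n μ.transpose := by
  intro i j hij
  rw [hookLength_transpose]
  exact h j i (by simpa [YoungDiagram.mem_transpose] using hij)

theorem transpose_mem_cores {s m : ℕ} {μ : YoungDiagram} (h : μ ∈ cores s m) :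
    μ.transpose ∈ cores s m :=
  ⟨h.1.transpose, h.2.1.transpose, h.2.2.transpose⟩

theorem card_transpose (μ : YoungDiagram) : μ.transpose.card = μ.card := by
  simp [YoungDiagram.card, YoungDiagram.transpose]

theorem lt_rowLen_iff_lt_colLen (μ : YoungDiagram) (i j : ℕ) :
    j < μ.rowLen i ↔ i < μ.colLen j := by
  rw [← YoungDiagram.mem_iff_lt_rowLen, YoungDiagram.mem_iff_lt_colLen]

theorem hookLength_zero {μ : YoungDiagram} {i : ℕ} (hi : i < μ.colLen 0) :
    hookLength μ i 0 = μ.rowLen i + (μ.colLen 0 - 1 - i) := by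
  have := (lt_rowLen_iff_lt_colLen μ i 0).2 hi
  simp only [hookLength]
  omega

theorem mem_betaSet {μ : YoungDiagram} {x : ℕ} :
    x ∈ betaSet μ ↔ ∃ i < μ.colLen 0, x = μ.rowLen i + (μ.colLen 0 - 1 - i) := by
  simp only [betaSet, Finset.mem_image, Finset.mem_range]
  constructor
  · rintro ⟨i, hi, rfl⟩
    exact ⟨i, hi, hookLength_zero hi⟩
  · rintro ⟨i, hi, rfl⟩
    exact ⟨i, hi, hookLength_zero hi⟩

theorem zero_notMem_betaSet (μ : YoungDiagram) : 0 ∉ betaSet μ := by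
  rw [mem_betaSet]
  rintro ⟨i, hi, h⟩
  have := (lt_rowLen_iff_lt_colLen μ i 0).2 hi
  omega

/-- The natural numbers missing from the `β`-set are `ℓ + j - μ'_j`, where `ℓ` is the number of
rows and `μ'_j` is the length of column `j`. -/
theorem notMem_betaSet_iff {μ : YoungDiagram} {x : ℕ} :
    x ∉ betaSet μ ↔ ∃ j, x + μ.colLen j = μ.colLen 0 + j := by
  rw [mem_betaSet]
  constructor
  · intro h
    by_contra hne
    push Not at h hne
    have hlt : ∀ j, μ.colLen 0 + j < x + μ.colLen j := by
      intro j
      induction j with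
      | zero => have := hne 0; omega
      | succ j ih =>
        by_contra hj
        have h1 := hne (j + 1)
        have hc := μ.colLen_anti 0 j (Nat.zero_le j)
        -- If the inequality flips between columns `j` and `j + 1`, this row ends exactly at length
        -- `j + 1`, and its first-column hook length is `x`.
        obtain ⟨i, hi⟩ : ∃ i, i + x = j + 1 + (μ.colLen 0 - 1) :=
          ⟨j + 1 + (μ.colLen 0 - 1) - x, by omega⟩
        have hij : j < μ.rowLen i := (lt_rowLen_iff_lt_colLen μ i j).2 (by omega)
        have hij' : ¬ j + 1 < μ.rowLen i := fun hh => by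
          have := (lt_rowLen_iff_lt_colLen μ i (j + 1)).1 hh
          omega
        exact h i (by omega) (by omega)
    have := hlt x
    have := μ.colLen_anti 0 x (Nat.zero_le x)
    omega
  · rintro ⟨j, hj⟩ ⟨i, hi, hx⟩
    have hc := μ.colLen_anti 0 j (Nat.zero_le j)
    rcases lt_or_ge j (μ.rowLen i) with h | h
    · have := (lt_rowLen_iff_lt_colLen μ i j).1 h
      omega
    · have : ¬ i < μ.colLen j := fun hh => by
        have := (lt_rowLen_iff_lt_colLen μ i j).2 hh
        omega
      omega

/-- Row `i` gives an element of the β-set and column `j` a missing number; when the cell `(i, j)`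
lies in the diagram, their difference is its hook length. Hence hook lengths are the differences
between elements and smaller missing numbers, and multiples of `n` are reached by repeated
subtraction. -/
theorem isCore_iff {n : ℕ} {μ : YoungDiagram} :
    IsCore n μ ↔ ∀ x ∈ betaSet μ, n ≤ x → x - n ∈ betaSet μ := by
  constructor
  · intro h x hx hn
    by_contra hxn
    obtain ⟨j, hj⟩ := notMem_betaSet_iff.1 hxn
    obtain ⟨i, hi, rfl⟩ := mem_betaSet.1 hx
    have hc := μ.colLen_anti 0 j (Nat.zero_le j)
    have hn0 : n ≠ 0 := by
      rintro rfl
      exact hxn (by simpa using hx)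
    have hij : j < μ.rowLen i := by
      by_contra hij
      have : ¬ i < μ.colLen j := fun hh => hij ((lt_rowLen_iff_lt_colLen μ i j).2 hh)
      omega
    have hij' := (lt_rowLen_iff_lt_colLen μ i j).1 hij
    refine h i j (YoungDiagram.mem_iff_lt_rowLen.2 hij) ?_
    have : hookLength μ i j = n := by
      simp only [hookLength]
      omega
    rw [this]
  · intro h i j hij
    have hj := YoungDiagram.mem_iff_lt_rowLen.1 hij
    have hi := YoungDiagram.mem_iff_lt_colLen.1 hij
    have hc := μ.colLen_anti 0 j (Nat.zero_le j)
    rintro ⟨c, hc'⟩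
    have key : ∀ k x, x ∈ betaSet μ → n * k ≤ x → x - n * k ∈ betaSet μ := by
      intro k
      induction k with
      | zero => intro x hx _; simpa using hx
      | succ k ih =>
        intro x hx hle
        rw [Nat.mul_succ] at hle ⊢
        have := h _ (ih x hx (by omega)) (by omega)
        rwa [Nat.sub_sub] at this
    have hx : μ.rowLen i + (μ.colLen 0 - 1 - i) ∈ betaSet μ :=
      mem_betaSet.2 ⟨i, by omega, rfl⟩
    simp only [hookLength] at hc'
    have h2 := key c _ hx (by omega)
    refine (notMem_betaSet_iff (μ := μ)).2 ⟨j, ?_⟩ h2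
    omega

theorem sum_betaSet (μ : YoungDiagram) (g : ℕ → ℕ) :
    ∑ x ∈ betaSet μ, g x = ∑ i ∈ Finset.range (μ.colLen 0),
      g (μ.rowLen i + (μ.colLen 0 - 1 - i)) := by
  rw [betaSet, Finset.sum_image]
  · exact Finset.sum_congr rfl fun i hi => by rw [hookLength_zero (Finset.mem_range.1 hi)]
  · intro i hi j hj hij
    simp only [Finset.coe_range, Set.mem_Iio] at hi hj
    dsimp only at hij
    rw [hookLength_zero hi, hookLength_zero hj] at hij
    rcases le_total i j with h | h
    · have := μ.rowLen_anti i j h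
      omega
    · have := μ.rowLen_anti j i h
      omega

theorem card_betaSet (μ : YoungDiagram) : (betaSet μ).card = μ.colLen 0 := by
  simpa using sum_betaSet μ fun _ => 1

theorem card_eq_sum_rowLen (μ : YoungDiagram) :
    μ.card = ∑ i ∈ Finset.range (μ.colLen 0), μ.rowLen i := by
  rw [YoungDiagram.card, Finset.card_eq_sum_card_fiberwise (f := Prod.fst)
    (t := Finset.range (μ.colLen 0))]
  · refine Finset.sum_congr rfl fun i _ => ?_
    rw [YoungDiagram.rowLen_eq_card, YoungDiagram.row]
  · rintro ⟨i, j⟩ hij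
    have h := YoungDiagram.mem_iff_lt_colLen.1 ((YoungDiagram.mem_cells _).1 hij)
    simpa using h.trans_le (μ.colLen_anti 0 j (Nat.zero_le j))

theorem two_mul_card (μ : YoungDiagram) :
    2 * (μ.card : ℤ) = 2 * ∑ x ∈ betaSet μ, (x : ℤ)
      - (betaSet μ).card * ((betaSet μ).card - 1) := by
  have h1 := sum_betaSet μ id
  simp only [id] at h1
  rw [Finset.sum_add_distrib, ← card_eq_sum_rowLen,
    Finset.sum_range_reflect (fun i => i) (μ.colLen 0)] at h1
  have h2 : ((∑ i ∈ Finset.range (μ.colLen 0), i : ℕ) : ℤ) * 2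
      = μ.colLen 0 * (μ.colLen 0 - 1) := by
    induction μ.colLen 0 with
    | zero => simp
    | succ k ih => rw [Finset.sum_range_succ]; push_cast at ih ⊢; linarith
  rw [card_betaSet, ← Nat.cast_sum, h1]
  push_cast at h2 ⊢
  linarith

theorem strictMono_fin_add_sub_le {k : ℕ} {f : Fin k → ℕ} (hf : StrictMono f) (i j : Fin k)
    (hij : i ≤ j) : f i + j ≤ f j + i := by
  obtain ⟨j, hj⟩ := j
  induction j with
  | zero =>
    have : i = ⟨0, hj⟩ := le_antisymm hij (Nat.zero_le _)
    rw [this]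
  | succ j ih =>
    rcases hij.lt_or_eq with h | h
    · have h1 := ih (by omega) (Nat.lt_succ_iff.1 (Fin.lt_def.1 h))
      have h2 : f ⟨j, by omega⟩ < f ⟨j + 1, hj⟩ := hf (Nat.lt_succ_self j)
      dsimp only at h1 ⊢
      omega
    · rw [h]

theorem rowLen_eq_zero {μ : YoungDiagram} {i : ℕ} (hi : μ.colLen 0 ≤ i) : μ.rowLen i = 0 := by
  by_contra h
  have := (lt_rowLen_iff_lt_colLen μ i 0).1 (Nat.pos_of_ne_zero h)
  omega

theorem betaSet_injective : Function.Injective betaSet := by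
  intro μ ν h
  have hl : μ.colLen 0 = ν.colLen 0 := by rw [← card_betaSet, ← card_betaSet, h]
  have mono : ∀ ρ : YoungDiagram,
      StrictMono fun k : Fin (ρ.colLen 0) => ρ.rowLen (ρ.colLen 0 - 1 - k) + k := by
    intro ρ a b hab
    have := ρ.rowLen_anti (ρ.colLen 0 - 1 - b) (ρ.colLen 0 - 1 - a) (by
      have := Fin.lt_def.1 hab
      omega)
    have := Fin.lt_def.1 hab
    dsimp only
    omega
  have range : ∀ ρ : YoungDiagram,
      Set.range (fun k : Fin (ρ.colLen 0) => ρ.rowLen (ρ.colLen 0 - 1 - k) + k)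
        = (betaSet ρ : Set ℕ) := by
    intro ρ
    ext x
    simp only [Set.mem_range, Finset.mem_coe, mem_betaSet]
    constructor
    · rintro ⟨k, rfl⟩
      have := k.2
      exact ⟨ρ.colLen 0 - 1 - k, by omega, by omega⟩
    · rintro ⟨i, hi, rfl⟩
      refine ⟨⟨ρ.colLen 0 - 1 - i, by omega⟩, ?_⟩
      dsimp only
      rw [show ρ.colLen 0 - 1 - (ρ.colLen 0 - 1 - i) = i by omega]
  have hrow : ∀ i, μ.rowLen i = ν.rowLen i := by
    have h1 := mono μ
    have h2 := mono ν
    have h3 := range μ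
    have h4 := range ν
    rw [h, ← h4] at h3
    intro i
    rcases lt_or_ge i (μ.colLen 0) with hi | hi
    · rw [← hl] at h2 h3
      have h5 := congrFun ((h1.range_inj h2).1 h3) ⟨μ.colLen 0 - 1 - i, by omega⟩
      dsimp only at h5
      rw [show μ.colLen 0 - 1 - (μ.colLen 0 - 1 - i) = i by omega] at h5
      omega
    · rw [rowLen_eq_zero hi, rowLen_eq_zero (hl ▸ hi)]
  ext ⟨i, j⟩
  rw [YoungDiagram.mem_cells, YoungDiagram.mem_cells, YoungDiagram.mem_iff_lt_rowLen,
    YoungDiagram.mem_iff_lt_rowLen, hrow]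

/-- The parts are the elements of `X` lowered by their rank. They are positive because `0 ∉ X`
forces the element of rank `k` to exceed `k`. -/
theorem exists_betaSet_eq (X : Finset ℕ) (hX : 0 ∉ X) : ∃ μ : YoungDiagram, betaSet μ = X := by
  set f := X.orderEmbOfFin rfl with hf
  have hlow : ∀ k : Fin X.card, (k : ℕ) < f k := by
    intro k
    have h1 := strictMono_fin_add_sub_le f.strictMono ⟨0, by have := k.2; omega⟩ k (Nat.zero_le _)
    have h2 : f ⟨0, by have := k.2; omega⟩ ≠ 0 := fun h0 =>
      hX (h0 ▸ X.orderEmbOfFin_mem rfl _)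
    dsimp only at h1
    omega
  let w : List ℕ := List.ofFn fun i : Fin X.card => f i.rev - i.rev
  have hw : w.SortedGE := by
    refine List.Pairwise.sortedGE ?_
    rw [List.pairwise_ofFn]
    intro a b hab
    have := strictMono_fin_add_sub_le f.strictMono b.rev a.rev (Fin.rev_le_rev.2 hab.le)
    have := hlow a.rev
    have := hlow b.rev
    omega
  have hpos : ∀ x ∈ w, 0 < x := by
    intro x hx
    obtain ⟨i, rfl⟩ := (List.mem_ofFn' _ _).1 hx
    exact Nat.sub_pos_of_lt (hlow _)
  have hlen : w.length = X.card := List.length_ofFn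
  refine ⟨YoungDiagram.ofRowLens w hw, ?_⟩
  have hcol : (YoungDiagram.ofRowLens w hw).colLen 0 = X.card := by
    rw [← YoungDiagram.length_rowLens, YoungDiagram.rowLens_length_ofRowLens hpos, hlen]
  have hrow : ∀ i : Fin X.card, (YoungDiagram.ofRowLens w hw).rowLen i = f i.rev - i.rev := by
    intro i
    have := YoungDiagram.rowLen_ofRowLens (hw := hw) ⟨i, by rw [hlen]; exact i.2⟩
    simpa [w] using this
  ext x
  rw [mem_betaSet, hcol]
  constructor
  · rintro ⟨i, hi, rfl⟩
    have h1 := hrow ⟨i, hi⟩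
    have h2 := hlow (Fin.rev ⟨i, hi⟩)
    have h3 : f (Fin.rev ⟨i, hi⟩) ∈ X := X.orderEmbOfFin_mem rfl _
    convert h3 using 1
    rw [Fin.val_rev] at h1 h2
    dsimp only at h1 h2
    omega
  · intro hx
    have : x ∈ Set.range f := by
      rw [hf, Finset.range_orderEmbOfFin]
      exact hx
    obtain ⟨k, rfl⟩ := this
    refine ⟨k.rev, k.rev.2, ?_⟩
    have := hlow k
    rw [hrow, Fin.rev_rev, Fin.val_rev]
    omega


/-! ### The energy form, and sets of least energy -/

/-- The kernel `d (s - d)`, where `d = |i - j|`; it depends only on the cyclic distance of the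
positions `i, j` on a cycle of length `s`. -/
def kernel (s i j : ℕ) : ℤ := |(i : ℤ) - j| * (s - |(i : ℤ) - j|)

/-- The bilinear form with matrix `kernel s`. -/
def bilin (s : ℕ) (x y : ℕ → ℤ) : ℤ :=
  ∑ i ∈ Finset.range s, ∑ j ∈ Finset.range s, x i * y j * kernel s i j

/-- The quadratic form with matrix `kernel s`. -/
def energy (s : ℕ) (x : ℕ → ℤ) : ℤ := bilin s x x

/-- The energy of the indicator function of a set of positions. -/
def setEnergy (s : ℕ) (Q : Finset ℕ) : ℤ := ∑ i ∈ Q, ∑ j ∈ Q, kernel s i j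

theorem kernel_comm (s i j : ℕ) : kernel s i j = kernel s j i := by
  rw [kernel, kernel, abs_sub_comm]

theorem kernel_self (s i : ℕ) : kernel s i i = 0 := by simp [kernel]

theorem kernel_nonneg {s i j : ℕ} (hi : i < s) (hj : j < s) : 0 ≤ kernel s i j := by
  refine mul_nonneg (abs_nonneg _) ?_
  rw [sub_nonneg, abs_le]
  omega

theorem kernel_pos {s i j : ℕ} (hi : i < s) (hj : j < s) (hij : i ≠ j) : 0 < kernel s i j := by
  refine mul_pos (abs_pos.2 (by omega)) ?_
  rw [sub_pos, abs_lt]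
  omega

theorem bilin_comm (s : ℕ) (x y : ℕ → ℤ) : bilin s x y = bilin s y x := by
  rw [bilin, bilin, Finset.sum_comm]
  exact Finset.sum_congr rfl fun i _ => Finset.sum_congr rfl fun j _ => by
    rw [kernel_comm s j i]; ring

theorem energy_lin_comb (s : ℕ) (x y : ℕ → ℤ) (a b : ℤ) :
    energy s (fun i => a * x i + b * y i)
      = a ^ 2 * energy s x + 2 * a * b * bilin s x y + b ^ 2 * energy s y := by
  have h : energy s (fun i => a * x i + b * y i)
      = a ^ 2 * energy s x + a * b * bilin s x y + a * b * bilin s y x + b ^ 2 * energy s y := by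
    simp only [energy, bilin, Finset.mul_sum, ← Finset.sum_add_distrib]
    exact Finset.sum_congr rfl fun i _ => Finset.sum_congr rfl fun j _ => by ring
  rw [h, bilin_comm s y x]
  ring

theorem bilin_single {s p q : ℕ} (hp : p < s) (hq : q < s) :
    bilin s (fun i => if i = p then 1 else 0) (fun i => if i = q then 1 else 0)
      = kernel s p q := by
  simp [bilin, hp, hq]

theorem energy_indicator {s : ℕ} {Q : Finset ℕ} (hQ : Q ⊆ Finset.range s) :
    energy s (fun i => if i ∈ Q then 1 else 0) = setEnergy s Q := by
  simp only [energy, bilin, setEnergy, ite_mul, one_mul, zero_mul, mul_ite, mul_one, mul_zero]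
  have h : ∀ f : ℕ → ℤ, ∑ i ∈ Finset.range s, (if i ∈ Q then f i else 0) = ∑ i ∈ Q, f i := by
    intro f
    rw [← Finset.sum_filter]
    congr 1
    ext i
    simpa using fun hi => Finset.mem_range.1 (hQ hi)
  rw [← h]
  refine Finset.sum_congr rfl fun i _ => ?_
  split_ifs
  · rw [h]
  · simp

theorem sum_kernel {s i : ℕ} (hi : i < s) :
    6 * ∑ j ∈ Finset.range s, kernel s i j = (s : ℤ) ^ 3 - s := by
  obtain ⟨q, rfl⟩ : ∃ q, s = i + (q + 1) := ⟨s - i - 1, by omega⟩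
  rw [Finset.sum_range_add]
  have h1 : ∑ j ∈ Finset.range i, kernel (i + (q + 1)) i j
      = ∑ j ∈ Finset.range i, ((i : ℤ) - j) * (q + 1 + j) := by
    refine Finset.sum_congr rfl fun j hj => ?_
    have := Finset.mem_range.1 hj
    rw [kernel, abs_of_nonneg (by omega)]
    push_cast
    ring
  have h2 : ∑ j ∈ Finset.range (q + 1), kernel (i + (q + 1)) i (i + j)
      = ∑ j ∈ Finset.range (q + 1), (j : ℤ) * (i + q + 1 - j) := by
    refine Finset.sum_congr rfl fun j _ => ?_
    rw [kernel, abs_of_nonpos (by push_cast; omega)]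
    push_cast
    ring
  have h3 : ∀ (n : ℕ) (a b : ℤ), 6 * ∑ j ∈ Finset.range n, (a - j) * (b + j)
      = 6 * a * b * n + 3 * (a - b) * n * (n - 1) - n * (n - 1) * (2 * n - 1) := by
    intro n a b
    induction n with
    | zero => simp
    | succ n ih => rw [Finset.sum_range_succ, mul_add, ih]; push_cast; ring
  have h4 : ∑ j ∈ Finset.range (q + 1), (j : ℤ) * (i + q + 1 - j)
      = ∑ j ∈ Finset.range (q + 1), ((i + q + 1 : ℤ) - j) * (0 + j) :=
    Finset.sum_congr rfl fun j _ => by ring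
  rw [h1, h2, h4, mul_add, h3, h3]
  push_cast
  ring

/-- The integer division is exact, since six times the row sum is `s ^ 3 - s`. -/
theorem sum_kernel_eq {s i : ℕ} (hi : i < s) :
    ∑ j ∈ Finset.range s, kernel s i j = ((s : ℤ) ^ 3 - s) / 6 := by
  rw [← sum_kernel hi]
  simp

/-- All row sums of the kernel agree, so pairing with a constant sequence sees only the sum of the
other one. -/
theorem energy_const_sub (s : ℕ) (a : ℤ) (x : ℕ → ℤ) :
    energy s (fun i => a - x i)
      = (((s : ℤ) ^ 3 - s) / 6) * (a ^ 2 * s - 2 * a * ∑ i ∈ Finset.range s, x i)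
        + energy s x := by
  set C := ((s : ℤ) ^ 3 - s) / 6
  have h := energy_lin_comb s (fun _ => 1) x a (-1)
  have h1 : ∀ y : ℕ → ℤ, bilin s (fun _ => 1) y = C * ∑ i ∈ Finset.range s, y i := by
    intro y
    rw [bilin_comm, bilin, Finset.mul_sum]
    refine Finset.sum_congr rfl fun i hi => ?_
    rw [← Finset.mul_sum, sum_kernel_eq (Finset.mem_range.1 hi)]
    ring
  have h2 : energy s (fun _ => 1) = C * s := by
    rw [energy, h1]
    simp
  rw [h1, h2] at h
  simp only [mul_one, neg_mul, one_mul, ← sub_eq_add_neg] at h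
  rw [h]
  ring

theorem sum_sign_sub {k i : ℕ} (hi : i < k) :
    ∑ j ∈ Finset.range k, ((k : ℤ) * Int.sign ((i : ℤ) - j) - 2 * ((i : ℤ) - j)) = 0 := by
  have h1 : ∑ j ∈ Finset.range k, Int.sign ((i : ℤ) - j) = 2 * i - k + 1 := by
    obtain ⟨q, rfl⟩ : ∃ q, k = i + 1 + q := ⟨k - i - 1, by omega⟩
    rw [Finset.sum_range_add, Finset.sum_range_succ, sub_self, Int.sign_zero,
      Finset.sum_congr rfl (g := fun _ => (1 : ℤ)) fun j hj => Int.sign_eq_one_of_pos (by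
        have := Finset.mem_range.1 hj
        omega),
      Finset.sum_congr rfl (s₁ := Finset.range q) (g := fun _ => (-1 : ℤ)) fun j _ =>
        Int.sign_eq_neg_one_of_neg (by omega)]
    simp
    ring
  have h2 : ∀ n : ℕ, 2 * ∑ j ∈ Finset.range n, ((i : ℤ) - j) = 2 * i * n - n * (n - 1) := by
    intro n
    induction n with
    | zero => simp
    | succ n ih => rw [Finset.sum_range_succ, mul_add, ih]; push_cast; ring
  rw [Finset.sum_sub_distrib, ← Finset.mul_sum, ← Finset.mul_sum, h1, h2]
  ring

/-- Monotonicity resolves both absolute values by the order of `i` and `j`, making the sum linear in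
`g`. The coefficients are the row sums of the antisymmetric weight `w`, which vanish by
`sum_sign_sub`. -/
theorem sum_abs_sub_mul_eq_zero {k : ℕ} {g : Fin k → ℤ} (hg : Monotone g) :
    ∑ i, ∑ j, |g i - g j| * ((k : ℤ) - 2 * |((i : ℕ) : ℤ) - (j : ℕ)|) = 0 := by
  let w : Fin k → Fin k → ℤ := fun i j =>
    (k : ℤ) * Int.sign (((i : ℕ) : ℤ) - (j : ℕ)) - 2 * (((i : ℕ) : ℤ) - (j : ℕ))
  have hw : ∀ i, ∑ j, w i j = 0 := fun i => by
    rw [Fin.sum_univ_eq_sum_range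
      (fun j => (k : ℤ) * Int.sign (((i : ℕ) : ℤ) - j) - 2 * (((i : ℕ) : ℤ) - j))]
    exact sum_sign_sub i.2
  have hanti : ∀ i j, w i j = - w j i := fun i j => by
    simp only [w]
    rw [← neg_sub ((j : ℕ) : ℤ), Int.sign_neg]
    ring
  have h1 : ∀ i j, |g i - g j| * ((k : ℤ) - 2 * |((i : ℕ) : ℤ) - (j : ℕ)|)
      = g i * w i j + g j * w j i := by
    intro i j
    rw [hanti j i]
    simp only [w]
    rcases lt_trichotomy i j with h | h | h
    · have h' := Fin.lt_def.1 h
      rw [abs_of_nonpos (sub_nonpos.2 (hg h.le)), abs_of_neg (by omega),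
        Int.sign_eq_neg_one_of_neg (by omega)]
      ring
    · subst h
      simp
    · have h' := Fin.lt_def.1 h
      rw [abs_of_nonneg (sub_nonneg.2 (hg h.le)), abs_of_pos (by omega),
        Int.sign_eq_one_of_pos (by omega)]
      ring
  simp only [h1, Finset.sum_add_distrib]
  rw [Finset.sum_comm (f := fun i j => g j * w j i)]
  simp only [← Finset.mul_sum, hw]
  simp

theorem kernel_add_left (s a i j : ℕ) : kernel s (a + i) (a + j) = kernel s i j := by
  simp only [kernel]
  push_cast
  rw [add_sub_add_left_eq_sub]

theorem setEnergy_Ico (s a k : ℕ) :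
    setEnergy s (Finset.Ico a (a + k)) = setEnergy s (Finset.range k) := by
  simp only [setEnergy, Finset.sum_Ico_eq_sum_range, Nat.add_sub_cancel_left, kernel_add_left]

/-- The energy of a set exceeds that of an interval of the same size by a sum of nonnegative
terms. -/
theorem exists_setEnergy_eq {s : ℕ} {Q : Finset ℕ} (hQ : Q ⊆ Finset.range s) :
    ∃ g : Fin Q.card → ℤ,
      (∀ i, Q.orderEmbOfFin rfl i = g i + (i : ℕ)) ∧
      (∀ i j, 0 ≤ |g i - g j| * ((s : ℤ) - Q.card - |g i - g j|)) ∧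
      setEnergy s Q = setEnergy s (Finset.range Q.card)
        + ∑ i, ∑ j, |g i - g j| * ((s : ℤ) - Q.card - |g i - g j|) := by
  set q := Q.orderEmbOfFin rfl
  have hq := strictMono_fin_add_sub_le q.strictMono
  let g : Fin Q.card → ℤ := fun i => q i - (i : ℕ)
  have hg : Monotone g := by
    intro i j hij
    have := hq i j hij
    simp only [g]
    omega
  have hg0 : ∀ i, 0 ≤ g i := by
    intro i
    have := hq ⟨0, by have := i.2; omega⟩ i (Nat.zero_le _)
    simp only [g]
    dsimp only at this
    omega
  have hgs : ∀ i, g i ≤ s - Q.card := by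
    intro i
    have hi := i.2
    have h1 := hq i ⟨Q.card - 1, by omega⟩ (Fin.le_def.2 (by dsimp only; omega))
    have h2 := Finset.mem_range.1 (hQ (Q.orderEmbOfFin_mem rfl ⟨Q.card - 1, by omega⟩))
    simp only [g]
    dsimp only at h1
    change q _ < s at h2
    omega
  refine ⟨g, fun i => by simp only [g]; ring, fun i j => ?_, ?_⟩
  · refine mul_nonneg (abs_nonneg _) (sub_nonneg.2 (abs_le.2 ?_))
    have := hg0 i
    have := hg0 j
    have := hgs i
    have := hgs j
    constructor <;> linarith
  · have h1 : setEnergy s Q = ∑ i, ∑ j, kernel s (q i) (q j) := by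
      have h : ∀ f : ℕ → ℤ, ∑ x ∈ Q, f x = ∑ i, f (q i) := fun f => by
        rw [← Finset.sum_coe_sort, ← (Q.orderIsoOfFin rfl).toEquiv.sum_comp]
        rfl
      rw [setEnergy, h]
      exact Finset.sum_congr rfl fun i _ => h _
    have h2 : setEnergy s (Finset.range Q.card)
        = ∑ i : Fin Q.card, ∑ j : Fin Q.card, kernel s i j := by
      rw [setEnergy, ← Fin.sum_univ_eq_sum_range (fun i => ∑ j ∈ Finset.range Q.card, kernel s i j)]
      exact Finset.sum_congr rfl fun i _ => (Fin.sum_univ_eq_sum_range (kernel s i) _).symm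
    -- With `a = |i - j|`, `b = |g i - g j|` and `k = Q.card`, the distance of `q i` and `q j` is `a
    -- + b`, and `(a + b)(s - a - b) = a(s - a) + b(s - k - b) + b(k - 2a)`. The last terms sum to
    -- zero.
    have h3 : ∀ i j, kernel s (q i) (q j) = kernel s i j
        + |g i - g j| * ((s : ℤ) - Q.card - |g i - g j|)
        + |g i - g j| * ((Q.card : ℤ) - 2 * |((i : ℕ) : ℤ) - (j : ℕ)|) := by
      intro i j
      have h4 : |(q i : ℤ) - q j| = |((i : ℕ) : ℤ) - (j : ℕ)| + |g i - g j| := by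
        have e1 : (q i : ℤ) = g i + (i : ℕ) := by simp only [g]; ring
        have e2 : (q j : ℤ) = g j + (j : ℕ) := by simp only [g]; ring
        rw [e1, e2]
        rcases le_total i j with h | h
        · have := hg h
          have := Fin.le_def.1 h
          rw [abs_of_nonpos (by omega), abs_of_nonpos (by omega), abs_of_nonpos (by omega)]
          ring
        · have := hg h
          have := Fin.le_def.1 h
          rw [abs_of_nonneg (by omega), abs_of_nonneg (by omega), abs_of_nonneg (by omega)]
          ring
      rw [kernel, h4, kernel]
      ring
    rw [h1, h2]
    simp only [h3, Finset.sum_add_distrib]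
    rw [sum_abs_sub_mul_eq_zero hg, add_zero]

theorem setEnergy_range_card_le {s : ℕ} {Q : Finset ℕ} (hQ : Q ⊆ Finset.range s) :
    setEnergy s (Finset.range Q.card) ≤ setEnergy s Q := by
  obtain ⟨g, -, h, h'⟩ := exists_setEnergy_eq hQ
  rw [h']
  exact le_add_of_nonneg_right (Finset.sum_nonneg fun i _ => Finset.sum_nonneg fun j _ => h i j)

/-- Equality kills every excess term; the one for the least and greatest elements already suffices.
Either `Q` has no gaps, or it reaches both ends of `range s`, as an interval wrapping around the
cycle would. -/
theorem eq_or_eq_of_setEnergy_eq {s : ℕ} {Q : Finset ℕ} (hQ : Q ⊆ Finset.range s)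
    (h : setEnergy s Q = setEnergy s (Finset.range Q.card)) {a b : ℕ} (ha : a ∈ Q) (hb : b ∈ Q)
    (hab : ∀ x ∈ Q, a ≤ x ∧ x ≤ b) : b + 1 = a + Q.card ∨ b + 1 = a + s := by
  obtain ⟨g, hg, hnn, hsum⟩ := exists_setEnergy_eq hQ
  rw [hsum, add_eq_left] at h
  have hcard : 0 < Q.card := Finset.card_pos.2 ⟨a, ha⟩
  have hfirst : Q.orderEmbOfFin rfl ⟨0, hcard⟩ = a := by
    obtain ⟨i, hi⟩ : a ∈ Set.range (Q.orderEmbOfFin rfl) := by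
      rw [Finset.range_orderEmbOfFin]; exact ha
    refine le_antisymm ?_ (hab _ (Q.orderEmbOfFin_mem rfl _)).1
    rw [← hi]
    exact (Q.orderEmbOfFin rfl).monotone (Nat.zero_le _)
  have hlast : Q.orderEmbOfFin rfl ⟨Q.card - 1, by omega⟩ = b := by
    obtain ⟨i, hi⟩ : b ∈ Set.range (Q.orderEmbOfFin rfl) := by
      rw [Finset.range_orderEmbOfFin]; exact hb
    refine le_antisymm (hab _ (Q.orderEmbOfFin_mem rfl _)).2 ?_
    rw [← hi]
    refine (Q.orderEmbOfFin rfl).monotone (Fin.le_def.2 ?_)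
    have := i.2
    dsimp only
    omega
  have h0 := (Finset.sum_eq_zero_iff_of_nonneg
    (fun i _ => Finset.sum_nonneg fun j _ => hnn i j)).1 h ⟨Q.card - 1, by omega⟩ (Finset.mem_univ _)
  have h1 := (Finset.sum_eq_zero_iff_of_nonneg (fun j _ => hnn _ j)).1 h0 ⟨0, hcard⟩
    (Finset.mem_univ _)
  have e1 := hg ⟨0, hcard⟩
  have e2 := hg ⟨Q.card - 1, by omega⟩
  rw [hfirst] at e1
  rw [hlast] at e2
  dsimp only at e1 e2
  have hle : a + (Q.card - 1) ≤ b := by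
    have := strictMono_fin_add_sub_le (Q.orderEmbOfFin rfl).strictMono ⟨0, hcard⟩
      ⟨Q.card - 1, by omega⟩ (Nat.zero_le _)
    rw [hfirst, hlast] at this
    dsimp only at this
    omega
  rw [abs_of_nonneg (by omega)] at h1
  rcases mul_eq_zero.1 h1 with h2 | h2
  · left; omega
  · right; omega


/-! ### Step sequences of least energy -/

/-- The sequences of steps, bounded by `m` and with total `-1`, that describe the
`(s, ms - 1, ms + 1)`-cores. -/
def IsStepSeq (s m : ℕ) (e : ℕ → ℤ) : Prop :=
  (∀ i < s, |e i| ≤ m) ∧ ∑ i ∈ Finset.range s, e i = -1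

/-- The only step of a step sequence of least energy that may differ from `±m`. -/
def specialStep (s m : ℕ) : ℤ := if Even s then (m : ℤ) - 1 else -1

/-- The least energy of a step sequence. -/
def minEnergy (s m : ℕ) : ℤ :=
  (((s : ℤ) ^ 3 - s) / 6) * ((m : ℤ) ^ 2 * s - 2 * m * (m * s + 1))
    + 2 * m * (m + specialStep s m) * setEnergy s (Finset.range (s / 2))
    + 2 * m * (m - specialStep s m) * setEnergy s (Finset.range (s / 2 + 1))

/-- The steps indexed by `Q` are `-m`, the step `z` is special, and all others are `m`. -/
def HasShape (s m : ℕ) (e : ℕ → ℤ) (z : ℕ) (Q : Finset ℕ) : Prop :=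
  z < s ∧ Q ⊆ Finset.range s ∧ z ∉ Q ∧ Q.card = s / 2 ∧ e z = specialStep s m ∧
    ∀ i < s, i ≠ z → e i = if i ∈ Q then -(m : ℤ) else m

theorem energy_congr {s : ℕ} {x y : ℕ → ℤ} (h : ∀ i < s, x i = y i) : energy s x = energy s y := by
  simp only [energy, bilin]
  exact Finset.sum_congr rfl fun i hi => Finset.sum_congr rfl fun j hj => by
    rw [h i (Finset.mem_range.1 hi), h j (Finset.mem_range.1 hj)]

theorem neg_le_specialStep {s m : ℕ} (hm : 1 ≤ m) : -(m : ℤ) ≤ specialStep s m := by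
  rw [specialStep]
  split_ifs <;> omega

theorem specialStep_lt {s m : ℕ} : specialStep s m < m := by
  rw [specialStep]
  split_ifs <;> omega

/-- The left side is the sum of a sequence with `s / 2` steps `-m`, one special step and all others
`m`; the total `-1` thus dictates `specialStep`. -/
theorem mul_sub_add_specialStep {s m : ℕ} :
    (m : ℤ) * (s - 1 - 2 * (s / 2 : ℕ)) + specialStep s m = -1 := by
  rw [specialStep]
  split_ifs with h
  · have : ((s / 2 : ℕ) : ℤ) * 2 = s := by exact_mod_cast Nat.div_mul_cancel h.two_dvd
    linear_combination (-(m : ℤ)) * this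
  · have : ((s / 2 : ℕ) : ℤ) * 2 + 1 = s := by
      exact_mod_cast Nat.div_two_mul_two_add_one_of_odd (Nat.not_even_iff_odd.1 h)
    linear_combination (-(m : ℤ)) * this

theorem HasShape.sum_eq {s m : ℕ} {e : ℕ → ℤ} {z : ℕ} {Q : Finset ℕ} (h : HasShape s m e z Q) :
    ∑ i ∈ Finset.range s, e i = -1 := by
  obtain ⟨hz, hQ, hzQ, hcard, hez, he⟩ := h
  rw [← mul_sub_add_specialStep (s := s) (m := m), ← hez, ← hcard,
    ← Finset.sum_erase_add _ _ (Finset.mem_range.2 hz)]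
  congr 1
  rw [Finset.sum_congr rfl (g := fun i => (m : ℤ) - 2 * m * (if i ∈ Q then 1 else 0))
    fun i hi => by
      rw [he i (Finset.mem_range.1 (Finset.mem_of_mem_erase hi)) (Finset.ne_of_mem_erase hi)]
      split_ifs <;> ring]
  have : Q ⊆ (Finset.range s).erase z := fun i hi =>
    Finset.mem_erase.2 ⟨fun h => hzQ (h ▸ hi), hQ hi⟩
  rw [Finset.sum_sub_distrib, ← Finset.mul_sum, Finset.sum_ite_mem,
    Finset.inter_eq_right.2 this]
  simp [Finset.card_erase_of_mem (Finset.mem_range.2 hz), Nat.cast_sub (show 1 ≤ s by omega)]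
  ring

theorem HasShape.isStepSeq {s m : ℕ} {e : ℕ → ℤ} {z : ℕ} {Q : Finset ℕ} (hm : 1 ≤ m)
    (h : HasShape s m e z Q) : IsStepSeq s m e := by
  refine ⟨fun i hi => ?_, h.sum_eq⟩
  obtain ⟨hz, hQ, hzQ, hcard, hez, he⟩ := h
  by_cases hiz : i = z
  · rw [hiz, hez, abs_le]
    exact ⟨neg_le_specialStep hm, specialStep_lt.le⟩
  · rw [he i hi hiz]
    split_ifs <;> simp

/-- The sequence `m - e` is `2m` on `Q`, `m - c` at `z` and zero elsewhere. A single point has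
energy zero, so the cross term is the energy of `insert z Q` minus that of `Q`. -/
theorem HasShape.energy_eq {s m : ℕ} {e : ℕ → ℤ} {z : ℕ} {Q : Finset ℕ} (h : HasShape s m e z Q) :
    energy s e = (((s : ℤ) ^ 3 - s) / 6) * ((m : ℤ) ^ 2 * s - 2 * m * (m * s + 1))
      + 2 * m * (m + specialStep s m) * setEnergy s Q
      + 2 * m * (m - specialStep s m) * setEnergy s (insert z Q) := by
  have hsum := h.sum_eq
  obtain ⟨hz, hQ, hzQ, hcard, hez, he⟩ := h
  set c := specialStep s m
  let q : ℕ → ℤ := fun i => if i ∈ Q then 1 else 0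
  let d : ℕ → ℤ := fun i => if i = z then 1 else 0
  have h1 : energy s (fun i => (m : ℤ) - e i)
      = energy s (fun i => (2 * m) * q i + (m - c) * d i) := by
    refine energy_congr fun i hi => ?_
    simp only [q, d]
    by_cases hiz : i = z
    · simp [hiz, hzQ, hez]
    · rw [he i hi hiz]
      split_ifs <;> ring
  have h2 : energy s (fun i => 1 * q i + 1 * d i) = setEnergy s (insert z Q) := by
    rw [← energy_indicator (Finset.insert_subset (Finset.mem_range.2 hz) hQ)]
    refine energy_congr fun i _ => ?_
    simp only [q, d, Finset.mem_insert]
    by_cases hiz : i = z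
    · simp [hiz, hzQ]
    · simp [hiz]
  have h3 : energy s q = setEnergy s Q := energy_indicator hQ
  have h4 : energy s d = 0 := (bilin_single hz hz).trans (kernel_self s z)
  have h5 := energy_const_sub s m (fun i => m - e i)
  simp only [sub_sub_cancel] at h5
  rw [energy_lin_comb, h3, h4] at h1 h2
  rw [h5, h1, Finset.sum_sub_distrib, hsum]
  simp only [Finset.sum_const, Finset.card_range, nsmul_eq_mul]
  linear_combination (2 * m * (m - c) : ℤ) * h2

/-- If two steps were strictly inside the bounds, a unit could be moved between them either way. The
two new energies average to the old one plus the energy of the move, which is `-2 * kernel s p q <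
0`, so one of them is smaller. -/
theorem IsStepSeq.eq_or_eq_of_minimal {s m : ℕ} {e : ℕ → ℤ} (he : IsStepSeq s m e)
    (hmin : ∀ e', IsStepSeq s m e' → energy s e ≤ energy s e') {p q : ℕ} (hp : p < s) (hq : q < s)
    (hpq : p ≠ q) : |e p| = m ∨ |e q| = m := by
  by_contra! hne
  have hp' := abs_lt.1 ((he.1 p hp).lt_of_ne hne.1)
  have hq' := abs_lt.1 ((he.1 q hq).lt_of_ne hne.2)
  let dp : ℕ → ℤ := fun i => if i = p then 1 else 0
  let dq : ℕ → ℤ := fun i => if i = q then 1 else 0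
  let v : ℕ → ℤ := fun i => 1 * dp i + (-1) * dq i
  have hv : energy s v < 0 := by
    have h1 : energy s dp = 0 := (bilin_single hp hp).trans (kernel_self s p)
    have h2 : energy s dq = 0 := (bilin_single hq hq).trans (kernel_self s q)
    have h3 : bilin s dp dq = kernel s p q := bilin_single hp hq
    have := kernel_pos hp hq hpq
    rw [energy_lin_comb, h1, h2, h3]
    linarith
  have hstep : ∀ a : ℤ, |a| = 1 → IsStepSeq s m (fun i => 1 * e i + a * v i) := by
    intro a ha
    have ha' : a = 1 ∨ a = -1 := by
      rcases abs_eq (zero_le_one' ℤ) |>.1 ha with h | h <;> simp [h]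
    refine ⟨fun i hi => ?_, ?_⟩
    · have := abs_le.1 (he.1 i hi)
      simp only [v, dp, dq]
      rw [abs_le]
      rcases ha' with rfl | rfl <;> split_ifs with h1 h2 h2 <;> subst_vars <;>
        first
        | exact absurd rfl hpq
        | constructor <;> linarith
    · rw [Finset.sum_add_distrib, ← Finset.mul_sum, ← Finset.mul_sum, he.2]
      simp [v, dp, dq, Finset.sum_add_distrib, hp, hq]
  have h1 := hmin _ (hstep 1 rfl)
  have h2 := hmin _ (hstep (-1) rfl)
  rw [energy_lin_comb] at h1 h2
  linarith

theorem IsStepSeq.exists_hasShape {s m : ℕ} {e : ℕ → ℤ} (he : IsStepSeq s m e) (hm : 1 ≤ m)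
    (hmin : ∀ e', IsStepSeq s m e' → energy s e ≤ energy s e') : ∃ z Q, HasShape s m e z Q := by
  -- When every step is `±m`, some step `-m` is taken as special; the negative total provides one.
  -- Excluding `e z = m` makes the count of steps `-m` unique.
  obtain ⟨z, hz, hzm, hext⟩ : ∃ z < s, e z ≠ m ∧ ∀ i < s, i ≠ z → |e i| = m := by
    by_cases h : ∃ z < s, |e z| ≠ m
    · obtain ⟨z, hz, hzm⟩ := h
      refine ⟨z, hz, fun h => hzm (by simp [h]), fun i hi hiz => ?_⟩
      exact (he.eq_or_eq_of_minimal hmin hi hz hiz).resolve_right hzm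
    · push Not at h
      by_contra! hne
      have h0 : ∀ i < s, e i = m := by
        intro i hi
        by_contra him
        obtain ⟨j, hj, -, hj'⟩ := hne i hi him
        exact hj' (h j hj)
      have : 0 ≤ ∑ i ∈ Finset.range s, e i := Finset.sum_nonneg fun i hi => by
        rw [h0 i (Finset.mem_range.1 hi)]
        exact Int.natCast_nonneg m
      rw [he.2] at this
      omega
  let Q := {i ∈ Finset.range s | i ≠ z ∧ e i = -(m : ℤ)}
  have hQ : Q ⊆ Finset.range s := Finset.filter_subset _ _
  have hzQ : z ∉ Q := fun h => (Finset.mem_filter.1 h).2.1 rfl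
  have hval : ∀ i < s, i ≠ z → e i = if i ∈ Q then -(m : ℤ) else m := by
    intro i hi hiz
    split_ifs with h
    · exact (Finset.mem_filter.1 h).2.2
    · rcases (abs_eq (Int.natCast_nonneg m)).1 (hext i hi hiz) with h1 | h1
      · exact h1
      · exact absurd (Finset.mem_filter.2 ⟨Finset.mem_range.2 hi, hiz, h1⟩) h
  have hsum : (m : ℤ) * (s - 1 - 2 * Q.card) + e z = -1 := by
    rw [← he.2, ← Finset.sum_erase_add _ _ (Finset.mem_range.2 hz)]
    congr 1
    rw [Finset.sum_congr rfl (g := fun i => (m : ℤ) - 2 * m * (if i ∈ Q then 1 else 0))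
      fun i hi => by
        rw [hval i (Finset.mem_range.1 (Finset.mem_of_mem_erase hi)) (Finset.ne_of_mem_erase hi)]
        split_ifs <;> ring]
    have : Q ⊆ (Finset.range s).erase z := fun i hi =>
      Finset.mem_erase.2 ⟨fun h => hzQ (h ▸ hi), hQ hi⟩
    rw [Finset.sum_sub_distrib, ← Finset.mul_sum, Finset.sum_ite_mem,
      Finset.inter_eq_right.2 this]
    simp [Finset.card_erase_of_mem (Finset.mem_range.2 hz), Nat.cast_sub (show 1 ≤ s by omega)]
    ring
  have hb := abs_le.1 (he.1 z hz)
  have hlt : e z < m := lt_of_le_of_ne hb.2 hzm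
  have hm' : (1 : ℤ) ≤ m := by exact_mod_cast hm
  have hd1 : (s : ℤ) - 1 - 2 * Q.card < 1 := by
    by_contra! h
    nlinarith
  have hd2 : -1 ≤ (s : ℤ) - 1 - 2 * Q.card := by
    by_contra! h
    nlinarith
  have hcard : Q.card = s / 2 := by omega
  refine ⟨z, Q, hz, hQ, hzQ, hcard, ?_, hval⟩
  have := mul_sub_add_specialStep (s := s) (m := m)
  rw [← hcard] at this
  linarith

theorem HasShape.minEnergy_le {s m : ℕ} {e : ℕ → ℤ} {z : ℕ} {Q : Finset ℕ} (hm : 1 ≤ m)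
    (h : HasShape s m e z Q) : minEnergy s m ≤ energy s e := by
  rw [h.energy_eq, minEnergy]
  obtain ⟨hz, hQ, hzQ, hcard, -, -⟩ := h
  have hR : (insert z Q).card = s / 2 + 1 := by rw [Finset.card_insert_of_notMem hzQ, hcard]
  have h1 := setEnergy_range_card_le hQ
  have h2 := setEnergy_range_card_le (Finset.insert_subset (Finset.mem_range.2 hz) hQ)
  rw [hcard] at h1
  rw [hR] at h2
  have h3 : 0 ≤ (m : ℤ) + specialStep s m := by linarith [neg_le_specialStep (s := s) hm]
  have h4 : 0 ≤ (m : ℤ) - specialStep s m := by linarith [specialStep_lt (s := s) (m := m)]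
  gcongr

theorem exists_minimal_stepSeq {s m : ℕ} {e : ℕ → ℤ} (he : IsStepSeq s m e) :
    ∃ e₀, IsStepSeq s m e₀ ∧ ∀ e', IsStepSeq s m e' → energy s e₀ ≤ energy s e' := by
  obtain ⟨E, ⟨e₀, he₀, rfl⟩, hE⟩ := Int.exists_least_of_bdd
    (P := fun E => ∃ e', IsStepSeq s m e' ∧ energy s e' = E)
    ⟨∑ i ∈ Finset.range s, ∑ j ∈ Finset.range s, -((m : ℤ) * m) * kernel s i j, by
      rintro _ ⟨e', he', rfl⟩
      refine Finset.sum_le_sum fun i hi => Finset.sum_le_sum fun j hj => ?_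
      have hi := Finset.mem_range.1 hi
      have hj := Finset.mem_range.1 hj
      refine mul_le_mul_of_nonneg_right ?_ (kernel_nonneg hi hj)
      have h1 := mul_le_mul (he'.1 i hi) (he'.1 j hj) (abs_nonneg _) (Int.natCast_nonneg m)
      rw [← abs_mul] at h1
      exact (abs_le.1 h1).1⟩ ⟨_, e, he, rfl⟩
  exact ⟨e₀, he₀, fun e' he' => hE _ ⟨e', he', rfl⟩⟩

theorem IsStepSeq.minEnergy_le {s m : ℕ} {e : ℕ → ℤ} (he : IsStepSeq s m e) (hm : 1 ≤ m) :
    minEnergy s m ≤ energy s e := by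
  obtain ⟨e₀, he₀, hmin⟩ := exists_minimal_stepSeq he
  obtain ⟨z, Q, h⟩ := he₀.exists_hasShape hm hmin
  exact (h.minEnergy_le hm).trans (hmin e he)

/-- The weight `m - c` of `insert z Q` is always positive, but the weight `m + c` of `Q` can vanish,
and then `Q` itself is unconstrained. -/
theorem IsStepSeq.exists_hasShape_of_energy_eq {s m : ℕ} {e : ℕ → ℤ} (he : IsStepSeq s m e)
    (hm : 1 ≤ m) (h : energy s e = minEnergy s m) :
    ∃ z Q, HasShape s m e z Q ∧
      setEnergy s (insert z Q) = setEnergy s (Finset.range (s / 2 + 1)) ∧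
      (specialStep s m = -m ∨ setEnergy s Q = setEnergy s (Finset.range (s / 2))) := by
  obtain ⟨z, Q, hS⟩ := he.exists_hasShape hm fun e' he' => h ▸ he'.minEnergy_le hm
  refine ⟨z, Q, hS, ?_⟩
  rw [hS.energy_eq, minEnergy] at h
  obtain ⟨hz, hQ, hzQ, hcard, -, -⟩ := hS
  have hR : (insert z Q).card = s / 2 + 1 := by rw [Finset.card_insert_of_notMem hzQ, hcard]
  have h1 := setEnergy_range_card_le hQ
  have h2 := setEnergy_range_card_le (Finset.insert_subset (Finset.mem_range.2 hz) hQ)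
  rw [hcard] at h1
  rw [hR] at h2
  have hm' : (0 : ℤ) < 2 * m := by omega
  have h3 : 0 ≤ 2 * (m : ℤ) * (m + specialStep s m) :=
    mul_nonneg hm'.le (by linarith [neg_le_specialStep (s := s) hm])
  have h4 : 0 < 2 * (m : ℤ) * (m - specialStep s m) :=
    mul_pos hm' (by linarith [specialStep_lt (s := s) (m := m)])
  have h5 := mul_le_mul_of_nonneg_left h1 h3
  have h6 := mul_le_mul_of_nonneg_left h2 h4.le
  constructor
  · exact mul_left_cancel₀ h4.ne' (by linarith)
  · by_cases hc : specialStep s m = -m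
    · exact Or.inl hc
    · have h7 : 2 * (m : ℤ) * (m + specialStep s m) ≠ 0 :=
        mul_ne_zero hm'.ne' fun h => hc (by linarith)
      exact Or.inr (mul_left_cancel₀ h7 (by linarith))

/-- The steps of the core whose `β`-set is `bigL m s`. -/
def maxSteps (s m i : ℕ) : ℤ :=
  if i < s - 1 - s / 2 then m else if i = s - 1 - s / 2 then specialStep s m else -m

/-- The steps of the conjugate of the core whose `β`-set is `bigL m s`. -/
def conjMaxSteps (s m i : ℕ) : ℤ :=
  if Even s then if i = 0 then m - 1 else if i < s / 2 then m else -m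
  else if i = s - 1 then -1 else if i < s / 2 then m else -m

theorem hasShape_maxSteps {s m : ℕ} (hs : 1 ≤ s) :
    HasShape s m (maxSteps s m) (s - 1 - s / 2) (Finset.Ico (s - s / 2) s) := by
  refine ⟨by omega, fun i hi => by simp at hi ⊢; omega, by simp; omega, by simp; omega, ?_, ?_⟩
  · simp [maxSteps]
  · intro i hi hiz
    simp only [maxSteps, Finset.mem_Ico]
    split_ifs <;> first | rfl | omega

theorem energy_maxSteps {s m : ℕ} (hs : 1 ≤ s) : energy s (maxSteps s m) = minEnergy s m := by
  rw [(hasShape_maxSteps hs).energy_eq, minEnergy]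
  have h1 := setEnergy_Ico s (s - s / 2) (s / 2)
  have h2 := setEnergy_Ico s (s - 1 - s / 2) (s / 2 + 1)
  rw [show s - s / 2 + s / 2 = s by omega] at h1
  rw [show s - 1 - s / 2 + (s / 2 + 1) = s by omega] at h2
  have h3 : insert (s - 1 - s / 2) (Finset.Ico (s - s / 2) s) = Finset.Ico (s - 1 - s / 2) s := by
    ext i
    simp only [Finset.mem_insert, Finset.mem_Ico]
    omega
  rw [h3, h1, h2]

theorem eq_Ico_of_setEnergy_eq {s : ℕ} {Q : Finset ℕ} (hQ : Q ⊆ Finset.range s)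
    (h : setEnergy s Q = setEnergy s (Finset.range Q.card)) (h0 : 0 ∉ Q) (hs : s - 1 ∈ Q) :
    Q = Finset.Ico (s - Q.card) s := by
  have hne : Q.Nonempty := ⟨_, hs⟩
  have hmin := Q.min'_mem hne
  have hpos : Q.min' hne ≠ 0 := fun hh => h0 (hh ▸ hmin)
  have hlt : ∀ x ∈ Q, x < s := fun x hx => Finset.mem_range.1 (hQ hx)
  have := hlt _ hs
  have key := eq_or_eq_of_setEnergy_eq hQ h hmin hs fun x hx =>
    ⟨Q.min'_le x hx, by have := hlt x hx; omega⟩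
  refine Finset.eq_of_subset_of_card_le (fun x hx => ?_) (by rw [Nat.card_Ico]; omega)
  have := Q.min'_le x hx
  have := hlt x hx
  rw [Finset.mem_Ico]
  omega

/-- For even `s`, `Q` is the upper half and `z` must extend it to a cyclic interval, from below or
across `0`. For odd `s`, `insert z Q` is an interval ending at `s - 1` and `z` is one of its ends.
-/
theorem IsStepSeq.eq_maxSteps_or {s m : ℕ} {e : ℕ → ℤ} (he : IsStepSeq s m e) (hs : 1 ≤ s)
    (hm : 1 ≤ m) (h : energy s e = minEnergy s m) (hfirst : 2 ≤ s → 0 ≤ e 0)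
    (hlast : e (s - 1) < 0) :
    (∀ i < s, e i = maxSteps s m i) ∨ (∀ i < s, e i = conjMaxSteps s m i) := by
  obtain ⟨z, Q, ⟨hz, hQ, hzQ, hcard, hez, hval⟩, hR, hQ'⟩ := he.exists_hasShape_of_energy_eq hm h
  have hm' : (1 : ℤ) ≤ m := by exact_mod_cast hm
  have hRc : (insert z Q).card = s / 2 + 1 := by rw [Finset.card_insert_of_notMem hzQ, hcard]
  have hRs := Finset.insert_subset (Finset.mem_range.2 hz) hQ
  have hltQ : ∀ x ∈ Q, x < s := fun x hx => Finset.mem_range.1 (hQ hx)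
  rcases hs.eq_or_lt with rfl | hs2
  · left
    intro i hi
    have hi0 : i = 0 := by omega
    have hz0 : z = 0 := by omega
    subst hi0 hz0
    rw [hez]
    simp [maxSteps]
  have hfirst := hfirst hs2
  have hnegQ : ∀ i ∈ Q, e i = -m := fun i hi => by
    rw [hval i (hltQ i hi) fun hh => hzQ (hh ▸ hi), if_pos hi]
  have h0Q : 0 ∉ Q := fun hh => by
    have := hnegQ 0 hh
    linarith
  have hlast' : s - 1 ∈ insert z Q := by
    by_contra hh
    rw [Finset.mem_insert, not_or] at hh
    have := hval (s - 1) (by omega) hh.1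
    rw [if_neg hh.2] at this
    linarith
  by_cases hev : Even s
  · have hc : specialStep s m = m - 1 := by simp [specialStep, hev]
    rw [hc] at hQ' hez
    have hlQ : s - 1 ∈ Q := by
      refine (Finset.mem_insert.1 hlast').resolve_left fun hh => ?_
      rw [hh, hez] at hlast
      linarith
    have hQE := hQ'.resolve_left (by omega)
    rw [← hcard] at hQE
    have hQI := eq_Ico_of_setEnergy_eq hQ hQE h0Q hlQ
    rw [hcard] at hQI
    have hs' := Nat.div_two_mul_two_of_even hev
    rw [hQI, Finset.mem_Ico] at hzQ
    rw [← hRc] at hR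
    have key := eq_or_eq_of_setEnergy_eq hRs hR (Finset.mem_insert_self z Q) hlast' fun x hx => by
      rcases Finset.mem_insert.1 hx with rfl | hx
      · omega
      · rw [hQI, Finset.mem_Ico] at hx
        omega
    rw [hRc] at key
    have hval' : ∀ i < s, i ≠ z → e i = if s / 2 ≤ i then -(m : ℤ) else m := by
      intro i hi hiz
      rw [hval i hi hiz, hQI]
      exact if_congr (by rw [Finset.mem_Ico]; omega) rfl rfl
    rcases key with key | key
    · left
      intro i hi
      rw [maxSteps, hc]
      by_cases hiz : i = z
      · rw [hiz, hez, if_neg (by omega), if_pos (by omega)]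
      · rw [hval' i hi hiz]
        split_ifs <;> first | rfl | omega
    · right
      intro i hi
      rw [conjMaxSteps, if_pos hev]
      by_cases hiz : i = z
      · rw [hiz, hez, if_pos (by omega)]
      · rw [hval' i hi hiz]
        split_ifs <;> first | rfl | omega
  · have hc : specialStep s m = -1 := by simp [specialStep, hev]
    rw [hc] at hQ' hez
    have hs' := Nat.div_two_mul_two_add_one_of_odd (Nat.not_even_iff_odd.1 hev)
    have h0R : 0 ∉ insert z Q := fun hh => by
      rcases Finset.mem_insert.1 hh with hh | hh
      · rw [hh, hez] at hfirst
        linarith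
      · exact h0Q hh
    rw [← hRc] at hR
    have hRI := eq_Ico_of_setEnergy_eq hRs hR h0R hlast'
    rw [hRc] at hRI
    have hmemR : ∀ i, i ∈ insert z Q ↔ s / 2 ≤ i ∧ i < s := by
      intro i
      rw [hRI, Finset.mem_Ico]
      omega
    have hmemQ : ∀ i, i ≠ z → (i ∈ Q ↔ s / 2 ≤ i ∧ i < s) := by
      intro i hiz
      rw [← hmemR, Finset.mem_insert]
      simp [hiz]
    have hzR := (hmemR z).1 (Finset.mem_insert_self z Q)
    have hval' : ∀ i < s, i ≠ z → e i = if s / 2 ≤ i then -(m : ℤ) else m := by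
      intro i hi hiz
      rw [hval i hi hiz]
      exact if_congr (by rw [hmemQ i hiz]; omega) rfl rfl
    rcases hQ' with hQ' | hQE
    · left
      -- Here the special step equals `-m`, so its position does not affect the sequence.
      have hm1 : (m : ℤ) = 1 := by omega
      intro i hi
      rw [maxSteps, hc]
      by_cases hiz : i = z
      · rw [hiz, hez, hm1]
        split_ifs <;> first | rfl | omega
      · rw [hval' i hi hiz, hm1]
        split_ifs <;> first | rfl | omega
    · have key : z = s / 2 ∨ z = s - 1 := by
        by_contra! hne
        have h1 := (hmemQ (s / 2) (Ne.symm hne.1)).2 (by omega)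
        have h2 := (hmemQ (s - 1) (Ne.symm hne.2)).2 (by omega)
        rw [← hcard] at hQE
        have := eq_or_eq_of_setEnergy_eq hQ hQE h1 h2 fun x hx => by
          have := (hmemR x).1 (Finset.mem_insert_of_mem hx)
          omega
        omega
      rcases key with key | key
      · left
        intro i hi
        rw [maxSteps, hc]
        by_cases hiz : i = z
        · rw [hiz, hez, if_neg (by omega), if_pos (by omega)]
        · rw [hval' i hi hiz]
          split_ifs <;> first | rfl | omega
      · right
        intro i hi
        rw [conjMaxSteps, if_neg hev]
        by_cases hiz : i = z
        · rw [hiz, hez, if_pos (by omega)]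
        · rw [hval' i hi hiz]
          split_ifs <;> first | rfl | omega


/-! ### The abacus: cores as step sequences, size as energy -/

/-- `n r` is the number of elements of `X` on runner `r` of the `s`-abacus, and these elements
are the lowest ones. -/
def IsRunnerCount (s : ℕ) (X : Finset ℕ) (n : ℕ → ℕ) : Prop :=
  ∀ r < s, ∀ k, s * k + r ∈ X ↔ k < n r

/-- The runner counts, continued by the value `-1` at `s`. -/
def height (s : ℕ) (n : ℕ → ℕ) (r : ℕ) : ℤ := if r < s then n r else -1

/-- The successive differences of the runner counts. -/
def steps (s : ℕ) (n : ℕ → ℕ) (i : ℕ) : ℤ := height s n (i + 1) - height s n i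

theorem exists_isRunnerCount {s : ℕ} (hs : 1 ≤ s) {X : Finset ℕ}
    (hX : ∀ x ∈ X, s ≤ x → x - s ∈ X) : ∃ n, IsRunnerCount s X n := by
  have hfin : ∀ r, ∃ k, s * k + r ∉ X := by
    intro r
    obtain ⟨b, hb⟩ := X.bddAbove
    refine ⟨b + 1, fun h => ?_⟩
    have := hb (Finset.mem_coe.2 h)
    nlinarith
  refine ⟨fun r => Nat.find (hfin r), fun r _ k => ⟨fun h => ?_, fun h => ?_⟩⟩
  · rw [Nat.lt_find_iff]
    intro l hl
    rw [not_not]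
    induction k with
    | zero => rwa [Nat.le_zero.1 hl]
    | succ k ih =>
      rcases hl.eq_or_lt with rfl | hl
      · exact h
      · refine ih ?_ (by omega)
        have := hX _ h (by rw [Nat.mul_succ]; omega)
        rwa [Nat.mul_succ, show s * k + s + r - s = s * k + r by omega] at this
  · by_contra hk
    exact Nat.find_min (hfin r) h hk

theorem IsRunnerCount.mem_iff {s : ℕ} (hs : 1 ≤ s) {X : Finset ℕ} {n : ℕ → ℕ}
    (h : IsRunnerCount s X n) (x : ℕ) : x ∈ X ↔ x / s < n (x % s) := by
  rw [← h _ (Nat.mod_lt x hs), Nat.div_add_mod]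

theorem IsRunnerCount.sum_eq {s : ℕ} (hs : 1 ≤ s) {X : Finset ℕ} {n : ℕ → ℕ}
    (h : IsRunnerCount s X n) (g : ℕ → ℤ) :
    ∑ x ∈ X, g x = ∑ r ∈ Finset.range s, ∑ k ∈ Finset.range (n r), g (s * k + r) := by
  rw [Finset.sum_sigma']
  refine Finset.sum_bij' (fun x _ => ⟨x % s, x / s⟩) (fun y _ => s * y.2 + y.1) ?_ ?_ ?_ ?_ ?_
  · intro x hx
    simpa [Nat.mod_lt x hs] using (h.mem_iff hs x).1 hx
  · rintro ⟨r, k⟩ hy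
    simp only [Finset.mem_sigma, Finset.mem_range] at hy
    exact (h r hy.1 k).2 hy.2
  · intro x _
    exact Nat.div_add_mod x s
  · rintro ⟨r, k⟩ hy
    simp only [Finset.mem_sigma, Finset.mem_range] at hy
    simp only [Nat.mul_add_mod, Nat.mod_eq_of_lt hy.1, Nat.mul_add_div hs,
      Nat.div_eq_of_lt hy.1, add_zero]
  · intro x _
    rw [Nat.div_add_mod]

theorem IsRunnerCount.zero {s : ℕ} (hs : 1 ≤ s) {X : Finset ℕ} {n : ℕ → ℕ}
    (h : IsRunnerCount s X n) (h0 : 0 ∉ X) : n 0 = 0 := by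
  have := h 0 hs 0
  simp only [mul_zero, add_zero, h0, false_iff] at this
  omega

theorem IsRunnerCount.eq {s : ℕ} (hs : 1 ≤ s) {X Y : Finset ℕ} {n n' : ℕ → ℕ}
    (h : IsRunnerCount s X n) (h' : IsRunnerCount s Y n') (h0 : n 0 = n' 0)
    (hstep : ∀ i < s, steps s n i = steps s n' i) : X = Y := by
  have hn : ∀ r < s, n r = n' r := by
    intro r
    induction r with
    | zero => exact fun _ => h0
    | succ r ih =>
      intro hr
      have h1 := ih (by omega)
      have h2 := hstep r (by omega)
      simp only [steps, height, if_pos hr, if_pos (show r < s by omega)] at h2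
      omega
  ext x
  rw [h.mem_iff hs, h'.mem_iff hs, hn _ (Nat.mod_lt x hs)]

theorem steps_sum {s : ℕ} (hs : 1 ≤ s) {n : ℕ → ℕ} (h0 : n 0 = 0) :
    ∑ i ∈ Finset.range s, steps s n i = -1 := by
  simp only [steps]
  rw [Finset.sum_range_sub (height s n)]
  simp [height, h0, show 0 < s by omega]

/-- Subtracting `ms - 1` or `ms + 1` lowers an entry by `m` rows and moves it one runner right or
left, which bounds the difference of neighbouring counts. Runner `s` would be runner `0` shifted
down by one row, whence its height `n 0 - 1 = -1`. -/
theorem isStepSeq_steps {s m : ℕ} (hs : 1 ≤ s) (hm : 1 ≤ m) {μ : YoungDiagram} {n : ℕ → ℕ}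
    (hμ : μ ∈ cores s m) (h : IsRunnerCount s (betaSet μ) n) : IsStepSeq s m (steps s n) := by
  have h0 := h.zero hs (zero_notMem_betaSet μ)
  obtain ⟨-, h1, h2⟩ := hμ
  rw [isCore_iff] at h1 h2
  refine ⟨fun i hi => ?_, steps_sum hs h0⟩
  rw [abs_le, steps, height, height, if_pos hi]
  split_ifs with hi'
  · constructor
    · by_contra! hlt
      have hx := (h i hi (n (i + 1) + m)).2 (by omega)
      have hle : m * s - 1 ≤ s * (n (i + 1) + m) + i := by
        rw [mul_add, mul_comm s m]; omega
      have hy := h1 _ hx hle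
      have hpos : 1 ≤ m * s := Nat.mul_pos hm hs
      rw [show s * (n (i + 1) + m) + i - (m * s - 1) = s * n (i + 1) + (i + 1) by
        rw [mul_add, mul_comm s m]; omega, h _ hi'] at hy
      exact lt_irrefl _ hy
    · by_contra! hlt
      have hx := (h (i + 1) hi' (n i + m)).2 (by omega)
      have hle : m * s + 1 ≤ s * (n i + m) + (i + 1) := by
        rw [mul_add, mul_comm s m]; omega
      have hy := h2 _ hx hle
      rw [show s * (n i + m) + (i + 1) - (m * s + 1) = s * n i + i by
        rw [mul_add, mul_comm s m]; omega, h _ hi] at hy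
      exact lt_irrefl _ hy
  -- On the last runner, a count exceeding `m - 1` would put `ms - 1`, and hence `0`, into the
  -- β-set.
  · refine ⟨?_, by omega⟩
    by_contra! hlt
    have hx := (h i hi (m - 1)).2 (by omega)
    obtain ⟨d, rfl⟩ : ∃ d, m = d + 1 := ⟨m - 1, by omega⟩
    have hxe : s * (d + 1 - 1) + i = (d + 1) * s - 1 := by
      rw [Nat.add_sub_cancel, add_mul, mul_comm s d]; omega
    rw [hxe] at hx
    have hy := h1 _ hx le_rfl
    rw [Nat.sub_self] at hy
    exact zero_notMem_betaSet μ hy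

theorem mem_cores_of_steps {s m : ℕ} (hs : 1 ≤ s) {μ : YoungDiagram} {n : ℕ → ℕ}
    (h : IsRunnerCount s (betaSet μ) n) (hstep : ∀ i < s, |steps s n i| ≤ m) : μ ∈ cores s m := by
  have h0 := h.zero hs (zero_notMem_betaSet μ)
  have hx : ∀ x ∈ betaSet μ, ∃ k r, r < s ∧ k < n r ∧ x = s * k + r := fun x hx =>
    ⟨x / s, x % s, Nat.mod_lt x hs, (h.mem_iff hs x).1 hx, (Nat.div_add_mod x s).symm⟩
  refine ⟨isCore_iff.2 ?_, isCore_iff.2 ?_, isCore_iff.2 ?_⟩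
  · intro x hxX hle
    obtain ⟨k, r, hr, hk, rfl⟩ := hx x hxX
    obtain ⟨k, rfl⟩ : ∃ l, k = l + 1 := ⟨k - 1, by
      rcases Nat.eq_zero_or_pos k with rfl | hk
      · simp at hle; omega
      · omega⟩
    rw [show s * (k + 1) + r - s = s * k + r by rw [mul_add]; omega]
    exact (h r hr k).2 (by omega)
  · intro x hxX hle
    obtain ⟨k, r, hr, hk, rfl⟩ := hx x hxX
    have hst := abs_le.1 (hstep r hr)
    rw [steps, height, height, if_pos hr] at hst
    split_ifs at hst with hr'
    · have hkm : m ≤ k := by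
        by_contra! hlt
        have := Nat.mul_le_mul_left s (Nat.succ_le_of_lt hlt)
        rw [Nat.succ_eq_add_one, mul_add, mul_comm s m] at this
        omega
      obtain ⟨l, rfl⟩ := Nat.exists_eq_add_of_le hkm
      have hpos : 1 ≤ m * s ∨ m = 0 := by
        rcases Nat.eq_zero_or_pos m with h | h
        · exact Or.inr h
        · exact Or.inl (Nat.mul_pos h hs)
      rcases hpos with hpos | rfl
      · rw [show s * (m + l) + r - (m * s - 1) = s * l + (r + 1) by
          rw [mul_add, mul_comm s m]; omega]
        exact (h _ hr' l).2 (by omega)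
      · simpa using hxX
    · exfalso
      have hkm : k + 2 ≤ m := by omega
      have := Nat.mul_le_mul_left s hkm
      rw [mul_add, mul_comm s m] at this
      omega
  · intro x hxX hle
    obtain ⟨k, r, hr, hk, rfl⟩ := hx x hxX
    obtain ⟨r, rfl⟩ : ∃ q, r = q + 1 := ⟨r - 1, by
      rcases Nat.eq_zero_or_pos r with rfl | hr
      · omega
      · omega⟩
    have hst := abs_le.1 (hstep r (by omega))
    rw [steps, height, height, if_pos hr, if_pos (by omega)] at hst
    have hkm : m ≤ k := by
      by_contra! hlt
      have := Nat.mul_le_mul_left s (Nat.succ_le_of_lt hlt)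
      rw [Nat.succ_eq_add_one, mul_add, mul_comm s m] at this
      omega
    obtain ⟨l, rfl⟩ := Nat.exists_eq_add_of_le hkm
    rw [show s * (m + l) + (r + 1) - (m * s + 1) = s * l + r by
      rw [mul_add, mul_comm s m]; omega]
    exact (h _ (by omega) l).2 (by omega)

theorem IsRunnerCount.four_mul_card {s : ℕ} (hs : 1 ≤ s) {μ : YoungDiagram} {n : ℕ → ℕ}
    (h : IsRunnerCount s (betaSet μ) n) :
    4 * (μ.card : ℤ) = 2 * s * ∑ r ∈ Finset.range s, (n r : ℤ) ^ 2
      + 4 * ∑ r ∈ Finset.range s, (r : ℤ) * n r - 2 * (∑ r ∈ Finset.range s, (n r : ℤ)) ^ 2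
      - (2 * s - 2) * ∑ r ∈ Finset.range s, (n r : ℤ) := by
  have h1 := two_mul_card μ
  have hN : ((betaSet μ).card : ℤ) = ∑ r ∈ Finset.range s, (n r : ℤ) := by
    simpa using h.sum_eq hs fun _ => 1
  have hsum : ∀ k r : ℕ, 2 * ∑ j ∈ Finset.range k, ((s * j + r : ℕ) : ℤ)
      = s * (k : ℤ) ^ 2 - s * k + 2 * (r * k) := by
    intro k r
    induction k with
    | zero => simp
    | succ k ih => rw [Finset.sum_range_succ, mul_add, ih]; push_cast; ring
  have hS : 2 * ∑ x ∈ betaSet μ, (x : ℤ) = s * ∑ r ∈ Finset.range s, (n r : ℤ) ^ 2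
      - s * ∑ r ∈ Finset.range s, (n r : ℤ) + 2 * ∑ r ∈ Finset.range s, (r : ℤ) * n r := by
    rw [h.sum_eq hs fun x => (x : ℤ), Finset.mul_sum]
    simp only [hsum, Finset.sum_add_distrib, Finset.sum_sub_distrib, ← Finset.mul_sum]
  rw [hN, hS] at h1
  linear_combination 2 * h1

/-- The distance `|i - j|` counts the cuts `r` separating `i` from `j`. The differences sum to `y r`
before the cut and to `y s - y r` after it; the factor `2` comes from the order of the pair. -/
theorem sum_sub_mul_abs (y : ℕ → ℤ) (h0 : y 0 = 0) (s : ℕ) :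
    ∑ i ∈ Finset.range s, ∑ j ∈ Finset.range s,
        (y (i + 1) - y i) * (y (j + 1) - y j) * |(i : ℤ) - j|
      = 2 * ∑ r ∈ Finset.range s, y r * (y s - y r) := by
  have hB : ∀ n : ℕ, ∑ i ∈ Finset.range n, (y (i + 1) - y i) * ((n : ℤ) - i)
      = ∑ r ∈ Finset.range (n + 1), y r := by
    intro n
    induction n with
    | zero => simp [h0]
    | succ n ih =>
      rw [Finset.sum_range_succ _ (n + 1), ← ih, Finset.sum_range_succ]
      have h1 : ∑ i ∈ Finset.range n, (y (i + 1) - y i) * (((n + 1 : ℕ) : ℤ) - i)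
          = ∑ i ∈ Finset.range n, (y (i + 1) - y i) * ((n : ℤ) - i)
            + ∑ i ∈ Finset.range n, (y (i + 1) - y i) := by
        rw [← Finset.sum_add_distrib]
        exact Finset.sum_congr rfl fun i _ => by push_cast; ring
      rw [h1, Finset.sum_range_sub, h0]
      push_cast
      ring
  induction s with
  | zero => simp
  | succ s ih =>
    have h1 : ∑ i ∈ Finset.range s, (y (i + 1) - y i) * (y (s + 1) - y s) * |(i : ℤ) - s|
        = (y (s + 1) - y s) * ∑ r ∈ Finset.range (s + 1), y r := by
      rw [← hB, Finset.mul_sum]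
      refine Finset.sum_congr rfl fun i hi => ?_
      have := Finset.mem_range.1 hi
      rw [abs_of_nonpos (by omega)]
      ring
    have h2 : ∑ j ∈ Finset.range s, (y (s + 1) - y s) * (y (j + 1) - y j) * |(s : ℤ) - j|
        = (y (s + 1) - y s) * ∑ r ∈ Finset.range (s + 1), y r := by
      rw [← h1]
      exact Finset.sum_congr rfl fun j _ => by rw [abs_sub_comm]; ring
    have h3 : ∑ r ∈ Finset.range s, y r * (y (s + 1) - y r)
        = ∑ r ∈ Finset.range s, y r * (y s - y r)
          + (y (s + 1) - y s) * ∑ r ∈ Finset.range s, y r := by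
      rw [Finset.mul_sum, ← Finset.sum_add_distrib]
      exact Finset.sum_congr rfl fun r _ => by ring
    simp only [Finset.sum_range_succ _ s, Finset.sum_add_distrib] at h1 h2 ⊢
    rw [ih, h1, h2, h3, sub_self, abs_zero]
    ring

/-- The kernel is `s |i - j| - (i - j) ^ 2`. The first part is `sum_sub_mul_abs`; the second depends
only on the moments of orders `0`, `1`, `2` of the differences, found by summation by parts. -/
theorem energy_sub (y : ℕ → ℤ) (h0 : y 0 = 0) (s : ℕ) (hys : y s = -1) :
    energy s (fun i => y (i + 1) - y i) = -(2 * s * ∑ r ∈ Finset.range s, y r ^ 2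
      + 4 * ∑ r ∈ Finset.range s, (r : ℤ) * y r - 2 * (∑ r ∈ Finset.range s, y r) ^ 2
      - (2 * s - 2) * ∑ r ∈ Finset.range s, y r) := by
  have hA := sum_sub_mul_abs y h0 s
  have h0' : ∀ n : ℕ, ∑ i ∈ Finset.range n, (y (i + 1) - y i) = y n := by
    intro n
    rw [Finset.sum_range_sub, h0, sub_zero]
  have h1' : ∀ n : ℕ, ∑ i ∈ Finset.range n, (i : ℤ) * (y (i + 1) - y i)
      = (n - 1) * y n - ∑ r ∈ Finset.range n, y r := by
    intro n
    induction n with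
    | zero => simp [h0]
    | succ n ih => rw [Finset.sum_range_succ, ih, Finset.sum_range_succ]; push_cast; ring
  have h2' : ∀ n : ℕ, ∑ i ∈ Finset.range n, (i : ℤ) ^ 2 * (y (i + 1) - y i)
      = (n - 1) ^ 2 * y n - 2 * ∑ r ∈ Finset.range n, (r : ℤ) * y r
        + ∑ r ∈ Finset.range n, y r := by
    intro n
    induction n with
    | zero => simp [h0]
    | succ n ih =>
      rw [Finset.sum_range_succ, ih, Finset.sum_range_succ, Finset.sum_range_succ]
      push_cast
      ring
  have hC : ∑ i ∈ Finset.range s, ∑ j ∈ Finset.range s,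
      (y (i + 1) - y i) * (y (j + 1) - y j) * ((i : ℤ) - j) ^ 2
      = 2 * (∑ i ∈ Finset.range s, (i : ℤ) ^ 2 * (y (i + 1) - y i))
          * (∑ i ∈ Finset.range s, (y (i + 1) - y i))
        - 2 * (∑ i ∈ Finset.range s, (i : ℤ) * (y (i + 1) - y i)) ^ 2 := by
    have e : ∀ i j : ℕ, (y (i + 1) - y i) * (y (j + 1) - y j) * ((i : ℤ) - j) ^ 2
        = ((i : ℤ) ^ 2 * (y (i + 1) - y i)) * (y (j + 1) - y j)
          + (y (i + 1) - y i) * ((j : ℤ) ^ 2 * (y (j + 1) - y j))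
          - 2 * (((i : ℤ) * (y (i + 1) - y i)) * ((j : ℤ) * (y (j + 1) - y j))) := by
      intro i j
      ring
    simp only [e, Finset.sum_add_distrib, Finset.sum_sub_distrib, ← Finset.mul_sum,
      ← Finset.sum_mul]
    ring
  rw [h0', h1', h2', hys] at hC
  rw [hys] at hA
  have hE : energy s (fun i => y (i + 1) - y i)
      = s * ∑ i ∈ Finset.range s, ∑ j ∈ Finset.range s,
          (y (i + 1) - y i) * (y (j + 1) - y j) * |(i : ℤ) - j|
        - ∑ i ∈ Finset.range s, ∑ j ∈ Finset.range s,
          (y (i + 1) - y i) * (y (j + 1) - y j) * ((i : ℤ) - j) ^ 2 := by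
    simp only [energy, bilin, Finset.mul_sum, ← Finset.sum_sub_distrib]
    refine Finset.sum_congr rfl fun i _ => Finset.sum_congr rfl fun j _ => ?_
    rw [kernel, ← sq_abs ((i : ℤ) - j)]
    ring
  have hq : ∑ r ∈ Finset.range s, y r * (-1 - y r)
      = -∑ r ∈ Finset.range s, y r - ∑ r ∈ Finset.range s, y r ^ 2 := by
    rw [← Finset.sum_neg_distrib, ← Finset.sum_sub_distrib]
    exact Finset.sum_congr rfl fun r _ => by ring
  rw [hE, hA, hC, hq]
  ring

theorem IsRunnerCount.energy_steps {s : ℕ} (hs : 1 ≤ s) {μ : YoungDiagram} {n : ℕ → ℕ}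
    (h : IsRunnerCount s (betaSet μ) n) : energy s (steps s n) = -(4 * (μ.card : ℤ)) := by
  have h0 := h.zero hs (zero_notMem_betaSet μ)
  have h1 := energy_sub (height s n) (by simp [height, h0, show 0 < s by omega]) s (by simp [height])
  have hh : ∀ r ∈ Finset.range s, height s n r = n r := fun r hr => by
    simp [height, Finset.mem_range.1 hr]
  rw [Finset.sum_congr rfl hh, Finset.sum_congr rfl fun r hr => by rw [hh r hr],
    Finset.sum_congr (f := fun r : ℕ => (r : ℤ) * height s n r) rfl fun r hr => by rw [hh r hr]] at h1
  rw [h.four_mul_card hs]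
  exact h1


/-! ### The core with β-set `bigL m s` -/

/-- The number of elements of `bigL m s` on runner `r` of the `s`-abacus. -/
def maxCount (s m r : ℕ) : ℕ := min (r * m) ((s - r) * m - 1)

theorem mem_bigL_iff {s m x : ℕ} (hs : 1 ≤ s) (hm : 1 ≤ m) :
    x ∈ bigL m s ↔ x / s < maxCount s m (x % s) := by
  have hiff : ∀ {i c r : ℕ}, c < m → r < s → (s * (m * i + c) + r) / s = m * i + c ∧
      (s * (m * i + c) + r) % s = r := by
    intro i c r _ hr
    rw [Nat.mul_add_div hs, Nat.div_eq_of_lt hr, Nat.mul_add_mod, Nat.mod_eq_of_lt hr, add_zero]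
    exact ⟨rfl, rfl⟩
  -- Row `i`, column `c * s + r` of the `ms`-abacus is row `m * i + c` of runner `r` of the
  -- `s`-abacus. The `-1` in `maxCount` matters only for `c + 1 = m`, matching the shorter base of
  -- the last pyramid.
  have hcount : ∀ {i c r : ℕ}, c < m → (m * i + c < maxCount s m r ↔
      i + 1 ≤ r ∧ (i + 1 ≤ s - r ∧ (c + 1 = m → i + 2 ≤ s - r))) := by
    intro i c r hc
    have h1 : m * i + c < r * m ↔ i + 1 ≤ r := by
      rw [← Nat.div_lt_iff_lt_mul hm, Nat.mul_add_div hm, Nat.div_eq_of_lt hc]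
      omega
    have h2 : m * i + c + 1 < (s - r) * m ↔ i + 1 ≤ s - r ∧ (c + 1 = m → i + 2 ≤ s - r) := by
      rw [← Nat.div_lt_iff_lt_mul hm, add_assoc, Nat.mul_add_div hm]
      by_cases hcm : c + 1 = m
      · rw [hcm, Nat.div_self hm]
        omega
      · rw [Nat.div_eq_of_lt (by omega)]
        omega
    rw [maxCount, lt_min_iff, h1, ← h2]
    omega
  rw [bigL, Set.mem_union]
  simp only [Set.mem_iUnion, Finset.mem_Icc, pyramid, Set.mem_ofPred_eq, exists_prop]
  constructor
  · rintro (⟨k, ⟨hk1, hk2⟩, i, j, h1, h2, rfl⟩ | ⟨i, j, h1, h2, rfl⟩)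
    · obtain ⟨c, rfl⟩ : ∃ c, k = c + 1 := ⟨k - 1, by omega⟩
      rw [Nat.add_sub_cancel] at h1
      rw [add_mul, one_mul] at h2
      obtain ⟨r, rfl⟩ : ∃ r, j = c * s + r := ⟨j - c * s, by omega⟩
      rw [show m * s * i + (c * s + r) = s * (m * i + c) + r by ring,
        (hiff (by omega) (by omega)).1, (hiff (by omega) (by omega)).2, hcount (by omega)]
      omega
    · obtain ⟨c, rfl⟩ : ∃ c, m = c + 1 := ⟨m - 1, by omega⟩
      rw [Nat.add_sub_cancel] at h1
      rw [add_mul c, one_mul] at h2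
      obtain ⟨r, rfl⟩ : ∃ r, j = c * s + r := ⟨j - c * s, by omega⟩
      rw [show (c + 1) * s * i + (c * s + r) = s * ((c + 1) * i + c) + r by ring,
        (hiff (by omega) (by omega)).1, (hiff (by omega) (by omega)).2, hcount (by omega)]
      omega
  · intro h
    have hr := Nat.mod_lt x hs
    have hc := Nat.mod_lt (x / s) hm
    have hx : x = m * s * (x / s / m) + (x / s % m * s + x % s) := by
      conv_lhs => rw [← Nat.div_add_mod x s, ← Nat.div_add_mod (x / s) m]
      ring
    rw [← Nat.div_add_mod (x / s) m, hcount hc] at h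
    generalize x / s / m = i at h hx
    generalize x / s % m = c at h hx hc
    generalize x % s = r at h hx hr
    by_cases hcm : c + 1 = m
    · right
      subst hcm
      refine ⟨i, c * s + r, ?_, ?_, hx⟩
      · rw [Nat.add_sub_cancel]; omega
      · rw [add_mul, one_mul]; omega
    · left
      refine ⟨c + 1, by omega, i, c * s + r, ?_, ?_, hx⟩
      · rw [Nat.add_sub_cancel]; omega
      · rw [add_mul, one_mul]; omega

theorem exists_betaSet_eq_bigL {s m : ℕ} (hs : 1 ≤ s) (hm : 1 ≤ m) :
    ∃ μ : YoungDiagram, (betaSet μ : Set ℕ) = bigL m s ∧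
      IsRunnerCount s (betaSet μ) (maxCount s m) := by
  let X := {x ∈ Finset.range (s * (s * m)) | x / s < maxCount s m (x % s)}
  have hX : ∀ x, x ∈ X ↔ x / s < maxCount s m (x % s) := by
    intro x
    rw [Finset.mem_filter, Finset.mem_range, and_iff_right_iff_imp]
    intro h
    rw [mul_comm, ← Nat.div_lt_iff_lt_mul hs]
    exact h.trans_le ((min_le_left _ _).trans (Nat.mul_le_mul_right m (Nat.mod_lt x hs).le))
  obtain ⟨μ, hμ⟩ := exists_betaSet_eq X (by simp [hX, maxCount])
  refine ⟨μ, ?_, fun r hr k => ?_⟩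
  · ext x
    rw [hμ, Finset.mem_coe, hX, mem_bigL_iff hs hm]
  · rw [hμ, hX, Nat.mul_add_div hs, Nat.div_eq_of_lt hr, Nat.mul_add_mod, Nat.mod_eq_of_lt hr,
      add_zero]

theorem maxCount_of_le {s m r : ℕ} (hm : 1 ≤ m) (h : 2 * r < s) :
    (maxCount s m r : ℤ) = r * m := by
  have h1 : (r + 1) * m ≤ (s - r) * m := Nat.mul_le_mul_right m (by omega)
  rw [add_mul, one_mul] at h1
  rw [maxCount, min_eq_left (by omega), Nat.cast_mul]

theorem maxCount_of_ge {s m r : ℕ} (hm : 1 ≤ m) (h : s ≤ 2 * r) (hr : r < s) :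
    (maxCount s m r : ℤ) = ((s : ℤ) - r) * m - 1 := by
  have h1 : (s - r) * m ≤ r * m := Nat.mul_le_mul_right m (by omega)
  have h2 : 1 ≤ (s - r) * m := Nat.mul_pos (by omega) hm
  rw [maxCount, min_eq_right (by omega), Nat.cast_sub h2, Nat.cast_mul, Nat.cast_sub hr.le,
    Nat.cast_one]

theorem steps_maxCount {s m : ℕ} (hm : 1 ≤ m) :
    ∀ i < s, steps s (maxCount s m) i = maxSteps s m i := by
  have hge : ∀ r, s ≤ 2 * r → r ≤ s →
      height s (maxCount s m) r = ((s : ℤ) - r) * m - 1 := by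
    intro r h1 h2
    rw [height]
    split_ifs with h
    · exact maxCount_of_ge hm h1 h
    · rw [show r = s by omega]
      ring
  have hle : ∀ r, 2 * r < s → height s (maxCount s m) r = (r : ℤ) * m := by
    intro r h
    rw [height, if_pos (by omega), maxCount_of_le hm h]
  intro i hi
  rw [steps, maxSteps]
  split_ifs with h1 h2
  · rw [hle _ (by omega), hle _ (by omega)]
    push_cast
    ring
  · rw [hge _ (by omega) (by omega), hle _ (by omega), specialStep]
    split_ifs with hev
    · have h3 := Nat.div_two_mul_two_of_even hev
      have h4 : (s : ℤ) = 2 * i + 2 := by omega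
      rw [h4]
      push_cast
      ring
    · have h3 := Nat.div_two_mul_two_add_one_of_odd (Nat.not_even_iff_odd.1 hev)
      have h4 : (s : ℤ) = 2 * i + 1 := by omega
      rw [h4]
      push_cast
      ring
  · rw [hge _ (by omega) (by omega), hge _ (by omega) (by omega)]
    push_cast
    ring


/-! ### The maximal size, and failure of self-conjugacy -/

theorem sum_quadratic (n : ℕ) (a b c : ℤ) :
    6 * ∑ j ∈ Finset.range n, (a + b * j + c * (j : ℤ) ^ 2)
      = 6 * a * n + 3 * b * n * (n - 1) + c * n * (n - 1) * (2 * n - 1) := by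
  induction n with
  | zero => simp
  | succ n ih => rw [Finset.sum_range_succ, mul_add, ih]; push_cast; ring

theorem sum_maxCount_odd {u m : ℕ} (hm : 1 ≤ m) (F : ℤ → ℤ → ℤ) :
    ∑ r ∈ Finset.range (2 * u + 1), F r (maxCount (2 * u + 1) m r)
      = ∑ r ∈ Finset.range (u + 1), F r (r * m)
        + ∑ j ∈ Finset.range u, F (u + 1 + j) (((u : ℤ) - j) * m - 1) := by
  rw [show 2 * u + 1 = (u + 1) + u by ring, Finset.sum_range_add]
  congr 1
  · refine Finset.sum_congr rfl fun r hr => ?_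
    rw [maxCount_of_le hm (by have := Finset.mem_range.1 hr; omega)]
  · refine Finset.sum_congr rfl fun j hj => ?_
    have := Finset.mem_range.1 hj
    rw [maxCount_of_ge hm (by omega) (by omega)]
    push_cast
    congr 1
    ring

theorem sum_maxCount_even {u m : ℕ} (hm : 1 ≤ m) (F : ℤ → ℤ → ℤ) :
    ∑ r ∈ Finset.range (2 * u), F r (maxCount (2 * u) m r)
      = ∑ r ∈ Finset.range u, F r (r * m)
        + ∑ j ∈ Finset.range u, F (u + j) (((u : ℤ) - j) * m - 1) := by
  rw [two_mul u, Finset.sum_range_add]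
  congr 1
  · refine Finset.sum_congr rfl fun r hr => ?_
    rw [maxCount_of_le hm (by have := Finset.mem_range.1 hr; omega)]
  · refine Finset.sum_congr rfl fun j hj => ?_
    have := Finset.mem_range.1 hj
    rw [maxCount_of_ge hm (by omega) (by omega)]
    push_cast
    congr 1
    ring

theorem sum_maxCount_odd_eq {u m : ℕ} (hm : 1 ≤ m) :
    ∑ r ∈ Finset.range (2 * u + 1), (maxCount (2 * u + 1) m r : ℤ) = m * u * (u + 1) - u := by
  have h1 := sum_quadratic (u + 1) 0 m 0
  have h2 := sum_quadratic u (u * m - 1) (-m) 0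
  rw [sum_maxCount_odd hm fun _ y => y,
    Finset.sum_congr (f := fun j : ℕ => (j : ℤ) * m) rfl
      (g := fun j : ℕ => (0 : ℤ) + m * j + 0 * (j : ℤ) ^ 2) fun j _ => by ring,
    Finset.sum_congr (f := fun j : ℕ => ((u : ℤ) - j) * m - 1) rfl
      (g := fun j : ℕ => ((u : ℤ) * m - 1) + -m * j + 0 * (j : ℤ) ^ 2) fun j _ => by ring]
  push_cast at h1 h2
  linarith

theorem sum_maxCount_even_eq {u m : ℕ} (hm : 1 ≤ m) :
    ∑ r ∈ Finset.range (2 * u), (maxCount (2 * u) m r : ℤ) = m * u ^ 2 - u := by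
  have h1 := sum_quadratic u 0 m 0
  have h2 := sum_quadratic u (u * m - 1) (-m) 0
  rw [sum_maxCount_even hm fun _ y => y,
    Finset.sum_congr (f := fun j : ℕ => (j : ℤ) * m) rfl
      (g := fun j : ℕ => (0 : ℤ) + m * j + 0 * (j : ℤ) ^ 2) fun j _ => by ring,
    Finset.sum_congr (f := fun j : ℕ => ((u : ℤ) - j) * m - 1) rfl
      (g := fun j : ℕ => ((u : ℤ) * m - 1) + -m * j + 0 * (j : ℤ) ^ 2) fun j _ => by ring]
  linarith

theorem six_mul_card_odd {u m : ℕ} (hm : 1 ≤ m) {μ : YoungDiagram}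
    (h : IsRunnerCount (2 * u + 1) (betaSet μ) (maxCount (2 * u + 1) m)) :
    6 * (μ.card : ℤ) = m ^ 2 * (u + 1) * u * ((u + 1) ^ 2 - (u + 1) + 1) := by
  have h1 := h.four_mul_card (by omega)
  have a1 := sum_quadratic (u + 1) 0 0 (m ^ 2)
  have a2 := sum_quadratic u ((u * m - 1) ^ 2) (-2 * m * (u * m - 1)) (m ^ 2)
  have b1 := sum_quadratic (u + 1) 0 0 m
  have b2 := sum_quadratic u ((u + 1) * (u * m - 1)) (u * m - 1 - (u + 1) * m) (-m)
  rw [sum_maxCount_odd_eq hm, sum_maxCount_odd hm fun _ y => y ^ 2,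
    sum_maxCount_odd hm fun x y => x * y,
    Finset.sum_congr (f := fun j : ℕ => ((j : ℤ) * m) ^ 2) rfl
      (g := fun j : ℕ => (0 : ℤ) + 0 * j + m ^ 2 * (j : ℤ) ^ 2) fun j _ => by ring,
    Finset.sum_congr (f := fun j : ℕ => (((u : ℤ) - j) * m - 1) ^ 2) rfl
      (g := fun j : ℕ => ((u : ℤ) * m - 1) ^ 2 + (-2 * m * (u * m - 1)) * j + m ^ 2 * (j : ℤ) ^ 2)
      fun j _ => by ring,
    Finset.sum_congr (f := fun j : ℕ => (j : ℤ) * (j * m)) rfl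
      (g := fun j : ℕ => (0 : ℤ) + 0 * j + m * (j : ℤ) ^ 2) fun j _ => by ring,
    Finset.sum_congr (f := fun j : ℕ => ((u : ℤ) + 1 + j) * (((u : ℤ) - j) * m - 1)) rfl
      (g := fun j : ℕ => ((u : ℤ) + 1) * (u * m - 1) + (u * m - 1 - (u + 1) * m) * j
        + -m * (j : ℤ) ^ 2) fun j _ => by ring] at h1
  push_cast at h1 a1 a2 b1 b2
  refine mul_left_cancel₀ (show (2 : ℤ) ≠ 0 by norm_num) ?_
  linear_combination 3 * h1 + (2 * u + 1) * (a1 + a2) + 2 * (b1 + b2)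

theorem six_mul_card_even {u m : ℕ} (hu : 1 ≤ u) (hm : 1 ≤ m) {μ : YoungDiagram}
    (h : IsRunnerCount (2 * u) (betaSet μ) (maxCount (2 * u) m)) :
    6 * (μ.card : ℤ) = m ^ 2 * u ^ 2 * ((u + 1) ^ 2 - 2 * (u + 1) + 3) - 3 * m * u ^ 2 := by
  have h1 := h.four_mul_card (by omega)
  have a1 := sum_quadratic u 0 0 (m ^ 2)
  have a2 := sum_quadratic u ((u * m - 1) ^ 2) (-2 * m * (u * m - 1)) (m ^ 2)
  have b1 := sum_quadratic u 0 0 m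
  have b2 := sum_quadratic u (u * (u * m - 1)) (u * m - 1 - u * m) (-m)
  rw [sum_maxCount_even_eq hm, sum_maxCount_even hm fun _ y => y ^ 2,
    sum_maxCount_even hm fun x y => x * y,
    Finset.sum_congr (f := fun j : ℕ => ((j : ℤ) * m) ^ 2) rfl
      (g := fun j : ℕ => (0 : ℤ) + 0 * j + m ^ 2 * (j : ℤ) ^ 2) fun j _ => by ring,
    Finset.sum_congr (f := fun j : ℕ => (((u : ℤ) - j) * m - 1) ^ 2) rfl
      (g := fun j : ℕ => ((u : ℤ) * m - 1) ^ 2 + (-2 * m * (u * m - 1)) * j + m ^ 2 * (j : ℤ) ^ 2)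
      fun j _ => by ring,
    Finset.sum_congr (f := fun j : ℕ => (j : ℤ) * (j * m)) rfl
      (g := fun j : ℕ => (0 : ℤ) + 0 * j + m * (j : ℤ) ^ 2) fun j _ => by ring,
    Finset.sum_congr (f := fun j : ℕ => ((u : ℤ) + j) * (((u : ℤ) - j) * m - 1)) rfl
      (g := fun j : ℕ => (u : ℤ) * (u * m - 1) + (u * m - 1 - u * m) * j
        + -m * (j : ℤ) ^ 2) fun j _ => by ring] at h1
  push_cast at h1 a1 a2 b1 b2
  refine mul_left_cancel₀ (show (2 : ℤ) ≠ 0 by norm_num) ?_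
  linear_combination 3 * h1 + (2 * u) * (a1 + a2) + 2 * (b1 + b2)

theorem IsRunnerCount.colLen_eq {s : ℕ} (hs : 1 ≤ s) {μ : YoungDiagram} {n : ℕ → ℕ}
    (h : IsRunnerCount s (betaSet μ) n) :
    (μ.colLen 0 : ℤ) = ∑ r ∈ Finset.range s, (n r : ℤ) := by
  rw [← card_betaSet]
  simpa using h.sum_eq hs fun _ => 1

/-- In a self-conjugate diagram with `ℓ > 0` rows the corner hook length is `2ℓ - 1`, and it belongs
to the β-set. -/
theorem transpose_ne_of_lt {μ : YoungDiagram} (h0 : 0 < μ.colLen 0)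
    (h : ∀ x ∈ betaSet μ, x + 1 < 2 * μ.colLen 0) : μ.transpose ≠ μ := by
  intro ht
  have h1 : μ.rowLen 0 = μ.colLen 0 := by rw [← YoungDiagram.colLen_transpose, ht]
  have h2 := h _ (mem_betaSet.2 ⟨0, h0, rfl⟩)
  omega

theorem transpose_ne {s m : ℕ} (hm : 1 ≤ m) (hs : 3 ≤ s) (h : 2 ≤ m ∨ Even s)
    {μ : YoungDiagram} (hμ : IsRunnerCount s (betaSet μ) (maxCount s m)) : μ.transpose ≠ μ := by
  have hm' : (1 : ℤ) ≤ m := by exact_mod_cast hm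
  have hcol := hμ.colLen_eq (by omega)
  rcases Nat.even_or_odd' s with ⟨u, rfl | rfl⟩
  · have hu : (2 : ℤ) ≤ u := by omega
    rw [sum_maxCount_even_eq hm] at hcol
    refine transpose_ne_of_lt (by
      zify
      rw [hcol]
      nlinarith [mul_le_mul hm' hu (by omega) (by omega)]) fun x hx => ?_
    have hk := (hμ.mem_iff (by omega) x).1 hx
    have hr := Nat.mod_lt x (show 0 < 2 * u by omega)
    rw [← Nat.div_add_mod x (2 * u)]
    generalize x / (2 * u) = k at hk ⊢
    generalize x % (2 * u) = r at hk hr ⊢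
    zify at hk hr ⊢
    rw [hcol]
    rcases lt_or_ge r u with hru | hru
    · rw [maxCount_of_le hm (by omega)] at hk
      have h1 : (r : ℤ) * m ≤ (u - 1) * m := by
        gcongr
        omega
      have h2 : (k : ℤ) ≤ u * m - 2 := by linarith
      nlinarith
    · rw [maxCount_of_ge hm (by omega) (by omega)] at hk
      push_cast at hk
      rcases hru.eq_or_lt with rfl | hru
      -- On this runner `x + 1 ≤ 2mu² - 3u + 1`, to be compared with `2ℓ = 2mu² - 2u`; this needs `u
      -- ≥ 2`.
      · have h2 : (k : ℤ) ≤ u * m - 2 := by linarith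
        nlinarith
      · have h1 : (2 * (u : ℤ) - r) * m ≤ (u - 1) * m :=
          mul_le_mul_of_nonneg_right (by omega) (by omega)
        have h2 : (k : ℤ) ≤ u * m - 3 := by linarith
        nlinarith
  · have hm2 : (2 : ℤ) ≤ m := by
      have := h.resolve_right (by simp)
      omega
    have hu : (1 : ℤ) ≤ u := by omega
    rw [sum_maxCount_odd_eq hm] at hcol
    refine transpose_ne_of_lt (by
      zify
      rw [hcol]
      nlinarith [mul_le_mul hm' hu (by omega) (by omega)]) fun x hx => ?_
    have hk := (hμ.mem_iff (by omega) x).1 hx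
    have hr := Nat.mod_lt x (show 0 < 2 * u + 1 by omega)
    rw [← Nat.div_add_mod x (2 * u + 1)]
    generalize x / (2 * u + 1) = k at hk ⊢
    generalize x % (2 * u + 1) = r at hk hr ⊢
    zify at hk hr ⊢
    rw [hcol]
    rcases lt_trichotomy r u with hru | rfl | hru
    · rw [maxCount_of_le hm (by omega)] at hk
      have h1 : (r : ℤ) * m ≤ (u - 1) * m := by
        gcongr
        omega
      have h2 : (k : ℤ) ≤ u * m - 2 := by linarith
      nlinarith
    · rw [maxCount_of_le hm (by omega)] at hk
      -- On the middle runner `x + 1 ≤ 2mr² + mr - r`, to be compared with `2ℓ = 2mr² + 2mr - 2r`;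
      -- this needs `m ≥ 2`.
      have h2 : (k : ℤ) ≤ r * m - 1 := by linarith
      nlinarith
    · rw [maxCount_of_ge hm (by omega) (by omega)] at hk
      push_cast at hk
      have h1 : (2 * (u : ℤ) + 1 - r) * m ≤ u * m := by
        gcongr
        omega
      have h2 : (k : ℤ) ≤ u * m - 2 := by linarith
      nlinarith

theorem conjMaxSteps_eq_maxSteps {s m : ℕ} (h : s < 3 ∨ (m = 1 ∧ ¬ Even s)) (hs : 1 ≤ s) :
    ∀ i < s, conjMaxSteps s m i = maxSteps s m i := by
  intro i hi
  by_cases hev : Even s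
  · have hs2 : s = 2 := by
      have := Nat.div_two_mul_two_of_even hev
      have := h.resolve_right fun hh => hh.2 hev
      omega
    subst hs2
    interval_cases i <;> simp [conjMaxSteps, maxSteps, specialStep]
  · have h1 := Nat.div_two_mul_two_add_one_of_odd (Nat.not_even_iff_odd.1 hev)
    rw [conjMaxSteps, if_neg hev, maxSteps, specialStep, if_neg hev]
    rcases h with h | ⟨rfl, -⟩
    · obtain rfl : s = 1 := by omega
      obtain rfl : i = 0 := by omega
      simp
    · push_cast
      split_ifs <;> first | rfl | omega

end CorePartition

/-! ### The main theorem -/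

theorem theorem1p1 (s m : ℕ) (hs : 1 ≤ s) (hm : 1 ≤ m) :
    (∀ t : ℕ, (s : ℤ) = 2 * t - 1 →
      IsGreatest ((fun μ : YoungDiagram => (μ.card : ℚ)) '' CorePartition.cores s m)
        ((m : ℚ) ^ 2 * t * (t - 1) * ((t : ℚ) ^ 2 - t + 1) / 6)) ∧
    (∀ t : ℕ, (s : ℤ) = 2 * t - 2 →
      IsGreatest ((fun μ : YoungDiagram => (μ.card : ℚ)) '' CorePartition.cores s m)
        ((m : ℚ) ^ 2 * ((t : ℚ) - 1) ^ 2 * ((t : ℚ) ^ 2 - 2 * t + 3) / 6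
          - (m : ℚ) * ((t : ℚ) - 1) ^ 2 / 2)) ∧
    ∃ lam : YoungDiagram,
      (CorePartition.betaSet lam : Set ℕ) = CorePartition.bigL m s ∧
      {μ | μ ∈ CorePartition.cores s m ∧ ∀ ν ∈ CorePartition.cores s m, ν.card ≤ μ.card}
        = {lam, lam.transpose} ∧
      (3 ≤ s → (2 ≤ m ∨ Even s) → lam.transpose ≠ lam) := by
  open CorePartition in
  obtain ⟨lam, hlam, hcount⟩ := exists_betaSet_eq_bigL hs hm
  have hlamcore : lam ∈ cores s m := mem_cores_of_steps hs hcount fun i hi => by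
    rw [steps_maxCount hm i hi]
    exact ((hasShape_maxSteps hs).isStepSeq hm).1 i hi
  have hlamE : -(4 * (lam.card : ℤ)) = minEnergy s m := by
    rw [← hcount.energy_steps hs, ← energy_maxSteps hs]
    exact energy_congr (steps_maxCount hm)
  have hruns : ∀ μ ∈ cores s m, ∃ n, IsRunnerCount s (betaSet μ) n := fun μ hμ =>
    exists_isRunnerCount hs (isCore_iff.1 hμ.1)
  have hle : ∀ μ ∈ cores s m, μ.card ≤ lam.card := by
    intro μ hμ
    obtain ⟨n, hn⟩ := hruns μ hμ
    have := (isStepSeq_steps hs hm hμ hn).minEnergy_le hm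
    rw [hn.energy_steps hs] at this
    omega
  have hcases : ∀ μ ∈ cores s m, μ.card = lam.card → ∃ n, IsRunnerCount s (betaSet μ) n ∧ n 0 = 0 ∧
      ((∀ i < s, steps s n i = maxSteps s m i) ∨ (∀ i < s, steps s n i = conjMaxSteps s m i)) := by
    intro μ hμ hcard
    obtain ⟨n, hn⟩ := hruns μ hμ
    have h0 := hn.zero hs (zero_notMem_betaSet μ)
    refine ⟨n, hn, h0, (isStepSeq_steps hs hm hμ hn).eq_maxSteps_or hs hm ?_ ?_ ?_⟩
    · rw [hn.energy_steps hs, hcard, hlamE]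
    · intro h2
      rw [steps, height, height, if_pos (by omega), if_pos (by omega), h0]
      simp
    · rw [steps, height, height, if_neg (by omega), if_pos (by omega)]
      omega
  have heq : ∀ μ n, IsRunnerCount s (betaSet μ) n → n 0 = 0 →
      (∀ i < s, steps s n i = maxSteps s m i) → μ = lam := by
    intro μ n hn h0 hst
    refine betaSet_injective (hn.eq hs hcount ?_ fun i hi => ?_)
    · rw [h0, hcount.zero hs (zero_notMem_betaSet lam)]
    · rw [hst i hi, steps_maxCount hm i hi]
  have hne : 3 ≤ s → (2 ≤ m ∨ Even s) → lam.transpose ≠ lam := fun h1 h2 =>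
    transpose_ne hm h1 h2 hcount
  refine ⟨?_, ?_, lam, hlam, ?_, hne⟩
  · intro t ht
    obtain ⟨u, rfl⟩ : ∃ u, t = u + 1 := ⟨t - 1, by omega⟩
    obtain rfl : s = 2 * u + 1 := by omega
    have hval := six_mul_card_odd hm hcount
    have hval' : ((m : ℚ) ^ 2 * (u + 1 : ℕ) * ((u + 1 : ℕ) - 1)
        * (((u + 1 : ℕ) : ℚ) ^ 2 - (u + 1 : ℕ) + 1) / 6) = lam.card := by
      have : (6 : ℚ) * lam.card = m ^ 2 * (u + 1) * u * ((u + 1) ^ 2 - (u + 1) + 1) := by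
        exact_mod_cast hval
      push_cast
      linear_combination (-1 / 6 : ℚ) * this
    rw [hval']
    refine ⟨⟨lam, hlamcore, rfl⟩, ?_⟩
    rintro _ ⟨μ, hμ, rfl⟩
    exact Nat.cast_le.2 (hle μ hμ)
  · intro t ht
    obtain ⟨u, rfl⟩ : ∃ u, t = u + 1 := ⟨t - 1, by omega⟩
    obtain rfl : s = 2 * u := by omega
    have hval := six_mul_card_even (by omega) hm hcount
    have hval' : ((m : ℚ) ^ 2 * (((u + 1 : ℕ) : ℚ) - 1) ^ 2
        * (((u + 1 : ℕ) : ℚ) ^ 2 - 2 * (u + 1 : ℕ) + 3) / 6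
          - (m : ℚ) * (((u + 1 : ℕ) : ℚ) - 1) ^ 2 / 2) = lam.card := by
      have : (6 : ℚ) * lam.card
          = m ^ 2 * u ^ 2 * ((u + 1) ^ 2 - 2 * (u + 1) + 3) - 3 * m * u ^ 2 := by
        exact_mod_cast hval
      push_cast
      linear_combination (-1 / 6 : ℚ) * this
    rw [hval']
    refine ⟨⟨lam, hlamcore, rfl⟩, ?_⟩
    rintro _ ⟨μ, hμ, rfl⟩
    exact Nat.cast_le.2 (hle μ hμ)
  · ext μ
    simp only [Set.mem_ofPred_eq, Set.mem_insert_iff, Set.mem_singleton_iff]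
    constructor
    · rintro ⟨hμ, hmax⟩
      obtain ⟨n, hn, h0, hst | hst⟩ := hcases μ hμ (le_antisymm (hle μ hμ) (hmax lam hlamcore))
      · exact Or.inl (heq μ n hn h0 hst)
      -- In the degenerate cases the two step sequences coincide. Otherwise `lam.transpose` is
      -- maximal and different from `lam`, so it has the second sequence, which it then shares with
      -- `μ`.
      · by_cases hdeg : s < 3 ∨ (m = 1 ∧ ¬ Even s)
        · refine Or.inl (heq μ n hn h0 fun i hi => ?_)
          rw [hst i hi, conjMaxSteps_eq_maxSteps hdeg hs i hi]
        · right
          push Not at hdeg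
          obtain ⟨n', hn', h0', hst' | hst'⟩ :=
            hcases lam.transpose (transpose_mem_cores hlamcore) (card_transpose lam)
          · exact absurd (heq _ n' hn' h0' hst')
              (hne hdeg.1
              ((Nat.lt_or_eq_of_le hm).imp id fun h1 => hdeg.2 h1.symm))
          · refine betaSet_injective (hn.eq hs hn' (h0.trans h0'.symm) fun i hi => ?_)
            rw [hst i hi, hst' i hi]
    · rintro (rfl | rfl)
      · exact ⟨hlamcore, hle⟩
      · exact ⟨transpose_mem_cores hlamcore, fun ν hν => by
          rw [card_transpose]
          exact hle ν hν⟩
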